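/- Let $n\in\mathbb N$, let $\Sigma_1,\Sigma_2$ be symmetric positive definite real $n\times n$ matrices, $C$ a symmetric positive semidefinite real $n\times n$ matrix, and $\lambda>1$. On the space $\mathbb S^n$ of symmetric $n\times n$ matrices with the Frobenius inner product $\langle X,Y\rangle=\operatorname{tr}(XY)$ and norm $\|\cdot\|_F$, put $$g(X)=-\log\det(X+\Sigma_1),\qquad h(X)=-\lambda\log\det(X+\Sigma_2),\qquad f=g-h,$$ with domains $\{X+\Sigma_1\succ0\}$ and $\{X+\Sigma_2\succ0\}$ (and value $+\infty$ outside), and $\mathcal C=\{X\in\mathbb S^n: 0\preceq X\preceq C\}$. Consider the problem of minimizing $f$ over $\mathcal C$. A DCA sequence is a sequence in $\mathcal C$ with $X^{(0)}\in\mathcal C$ and $$X^{(k+1)}\in\operatorname*{argmin}_{X\in\mathcal C}\ \big(g(X)-h(X^{(k)})-\langle\nabla h(X^{(k)}),X-X^{(k)}\rangle\big)\qquad(k\ge0).$$ Then there exist $X^\star\in\mathcal C$, $\mu>0$ and $r>0$ such that the following hold. (a) (Standing assumption.) 1. $g$ and $h$ are closed and convex, and are continuously differentiable on their (open) domains. 2.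 $\mathcal C$ is bounded, closed and convex, and $\mathcal C\subseteq\operatorname{dom}g\cap\operatorname{dom}h$. 3. $X^\star$ is a global minimizer of $f$ over $\mathcal C$. 4. The minimization problem that defines the DCA step has a solution for every $X^{(k)}\in\mathcal C$. 5. (Extended DC-PL inequality.) Let $h^*(U)=\sup_{X\in\operatorname{dom}h}(\langle U,X\rangle-h(X))\in(-\infty,+\infty]$ be the convex conjugate of $h$, $d_{h^*}(U,V)=h^*(U)-h^*(V)-\langle\nabla h^*(V),U-V\rangle$ the Bregman distance that it generates (equal to $+\infty$ if $h^*(U)=+\infty$), and $N_{\mathcal C}(X)=\{Y\in\mathbb S^n:\langle Y,Z-X\rangle\le0\ \text{for all } Z\in\mathcal C\}$ the normal cone. For every $X\in\mathcal C$ the point $\nabla h(X)$ lies in the interior of $\operatorname{dom}h^*$, $h^*$ is differentiable there, and $$\mu\,(f(X)-f(X^\star))\le d_{h^*}(\nabla g(X)+Y,\nabla h(X))\quad\text{for all }X\in\mathcal C,\ Y\in N_{\mathcal C}(X)\text{ with }\|Y\|_F\le r.$$ Moreover, $r>\|\nabla g(X)\|_F+\|\nabla h(Z)\|_F$ for all $X,Z\in\mathcal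 C$. (b) (Linear convergence of DCA to the minimizer.) $X^\star$ is the only global minimizer of $f$ over $\mathcal C$, and every DCA sequence satisfies $$f(X^{(k+1)})-f(X^\star)\le\frac1{1+\mu}\,\big(f(X^{(k)})-f(X^\star)\big)\qquad\text{for all }k\ge0.$$ Furthermore, there are constants $M$ and $\rho\in[0,1)$, independent of the sequence, such that every DCA sequence converges to $X^\star$ with $\|X^{(k)}-X^\star\|_F\le M\rho^k$ for all $k\ge0$. -/

import Mathlib

open Filter Topology

noncomputable section

/-! ### Difference-of-convex programs over a real Hilbert space -/

section DC

variable {E : Type*} [NormedAddCommGroup E] [InnerProductSpace ℝ E]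

/-- The convex conjugate `φ*(u) = sup_{x ∈ D} (⟪u, x⟫ - φ x)` of a function `φ` with domain `D`
(`φ = +∞` off `D`), with values in the extended reals. -/
def convexConj (D : Set E) (φ : E → ℝ) (u : E) : EReal :=
  ⨆ x ∈ D, ((inner ℝ u x - φ x : ℝ) : EReal)

/-- The effective domain of an extended-real-valued function. -/
def effDom (φ : E → EReal) : Set E := {u | φ u < ⊤}

/-- The Bregman distance `d_φ(u, v) = φ u - φ v - ⟪∇φ(v), u - v⟫` of an extended-real-valued
kernel `φ`, for `v` in the interior of its domain; it is `+∞` when `φ u = +∞`. -/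
def bregman [CompleteSpace E] (φ : E → EReal) (u v : E) : EReal :=
  φ u - φ v - ((inner ℝ (gradient (fun z => (φ z).toReal) v) (u - v) : ℝ) : EReal)

/-- The normal cone of `K` at a point `x` of `K`. -/
def normalConeAt (K : Set E) (x : E) : Set E := {y | ∀ z ∈ K, inner ℝ y (z - x) ≤ 0}

variable (E) in
/-- The data of a problem `minimize g x - h x subject to x ∈ feas`,
where `g` and `h` are functions with the domains `domG` and `domH`. -/
structure DCProblem where
  domG : Set E
  g : E → ℝ
  domH : Set E
  h : E → ℝ
  feas : Set E

/-- `φ`, with domain `D`, is a closed convex function (its epigraph is closed) that is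
continuously differentiable on its (open) domain. -/
structure IsClosedConvexC1 (D : Set E) (φ : E → ℝ) : Prop where
  isOpen_dom : IsOpen D
  convexOn : ConvexOn ℝ D φ
  isClosed_epigraph : IsClosed {p : E × ℝ | p.1 ∈ D ∧ φ p.1 ≤ p.2}
  contDiffOn : ContDiffOn ℝ 1 φ D

namespace DCProblem

/-- The objective `f = g - h`. -/
def f (P : DCProblem E) (x : E) : ℝ := P.g x - P.h x

/-- `x` is a global minimizer of the problem. -/
def IsMinimizer (P : DCProblem E) (x : E) : Prop := x ∈ P.feas ∧ IsMinOn P.f P.feas x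

variable [CompleteSpace E]

/-- `x'` is a possible outcome of one step of the difference-of-convex algorithm from `x`:
`x' ∈ argmin_{z ∈ feas} g z - (h x + ⟪∇h x, z - x⟫)`. -/
def IsDCAStep (P : DCProblem E) (x x' : E) : Prop :=
  x' ∈ P.feas ∧
    IsMinOn (fun z => P.g z - (P.h x + inner ℝ (gradient P.h x) (z - x))) P.feas x'

/-- A sequence produced by the difference-of-convex algorithm from a feasible starting point. -/
def IsDCASequence (P : DCProblem E) (x : ℕ → E) : Prop :=
  x 0 ∈ P.feas ∧ ∀ k, P.IsDCAStep (x k) (x (k + 1))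

/-- The standing assumption on a difference-of-convex program, with a global minimizer `xs`
and the constants `μ` and `r` of the extended DC-PL inequality. -/
structure StandingAssumption (P : DCProblem E) (xs : E) (μ r : ℝ) : Prop where
  g_convex : IsClosedConvexC1 P.domG P.g
  h_convex : IsClosedConvexC1 P.domH P.h
  feas_bounded : Bornology.IsBounded P.feas
  feas_closed : IsClosed P.feas
  feas_convex : Convex ℝ P.feas
  feas_subset : P.feas ⊆ P.domG ∩ P.domH
  minimizer : P.IsMinimizer xs
  solvable : ∀ x ∈ P.feas, ∃ x', P.IsDCAStep x x'
  mu_pos : 0 < μ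
  r_pos : 0 < r
  /-- the Bregman distance generated by `h*` is well defined in its second argument `∇h x` -/
  conj_regular : ∀ x ∈ P.feas,
    gradient P.h x ∈ interior (effDom (convexConj P.domH P.h)) ∧
    DifferentiableAt ℝ (fun u => (convexConj P.domH P.h u).toReal) (gradient P.h x)
  dcPL : ∀ x ∈ P.feas, ∀ y ∈ normalConeAt P.feas x, ‖y‖ ≤ r →
    ((μ * (P.f x - P.f xs) : ℝ) : EReal) ≤
      bregman (convexConj P.domH P.h) (gradient P.g x + y) (gradient P.h x)

end DCProblem

end DC

/-! ### The space of symmetric matrices with the Frobenius inner product -/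

/-- Symmetric real `n × n` matrices, as a subspace of the Euclidean space of all families of
`n × n` entries, so that the norm is the Frobenius norm. -/
def symSubmodule (n : ℕ) : Submodule ℝ (EuclideanSpace ℝ (Fin n × Fin n)) where
  carrier := {x | ∀ i j, x (i, j) = x (j, i)}
  add_mem' := by
    intro a b ha hb i j
    simp [ha i j, hb i j]
  zero_mem' := by
    intro i j
    simp
  smul_mem' := by
    intro c a ha i j
    simp [ha i j]

abbrev SymMat (n : ℕ) : Type := symSubmodule n

instance (n : ℕ) : CompleteSpace (SymMat n) := FiniteDimensional.complete ℝ _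

/-- The matrix of entries of a symmetric matrix. -/
def SymMat.toMat {n : ℕ} (X : SymMat n) : Matrix (Fin n) (Fin n) ℝ :=
  Matrix.of fun i j => (X : EuclideanSpace ℝ (Fin n × Fin n)) (i, j)

theorem SymMat.toMat_isHermitian {n : ℕ} (X : SymMat n) : X.toMat.IsHermitian := by
  ext i j
  simpa [SymMat.toMat] using X.2 j i

/-- The inner product of symmetric matrices is the trace inner product. -/
theorem SymMat.inner_eq_trace {n : ℕ} (X Y : SymMat n) :
    inner ℝ X Y = (X.toMat * Y.toMat).trace := by
  have hY : ∀ i j, (Y : EuclideanSpace ℝ (Fin n × Fin n)) (i, j) =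
    (Y : EuclideanSpace ℝ (Fin n × Fin n)) (j, i) := Y.2
  rw [Submodule.coe_inner, PiLp.inner_apply, Fintype.sum_prod_type]
  simp only [Matrix.trace, Matrix.diag, Matrix.mul_apply, SymMat.toMat, Matrix.of_apply]
  refine Finset.sum_congr rfl fun i _ => Finset.sum_congr rfl fun j _ => ?_
  rw [hY i j]
  simp [mul_comm]

/-! ### The two-receiver vector Gaussian broadcast problem -/

/-- The problem `minimize -log det (X + S₁) + lam log det (X + S₂)` subject to `0 ⪯ X ⪯ C` over
symmetric matrices, written with `g X = -log det (X + S₁)` and `h X = -lam log det (X + S₂)`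
on their natural domains. -/
def broadcastProblem {n : ℕ} (S₁ S₂ C : Matrix (Fin n) (Fin n) ℝ) (lam : ℝ) :
    DCProblem (SymMat n) where
  domG := {X | (X.toMat + S₁).PosDef}
  g X := -Real.log (X.toMat + S₁).det
  domH := {X | (X.toMat + S₂).PosDef}
  h X := -lam * Real.log (X.toMat + S₂).det
  feas := {X | X.toMat.PosSemidef ∧ (C - X.toMat).PosSemidef}

end

/-!
The whole statement follows from one error bound. For feasible `X` and a normal vector `Y` of the
feasible set at `X` such that `(X + S₁)⁻¹ - Y` is positive definite, let `Q` be the matrix with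
`lam Q⁻¹ = (X + S₁)⁻¹ - Y`. The conjugate `h*` is finite only at negative definite matrices, where
it is explicit, and the Bregman distance of the DC-PL inequality is `lam` times the Bregman
distance `logDetGap (X + S₂) Q` of `-log det` (`SymMat.bregman_convexConj`); it is `+∞` when
`(X + S₁)⁻¹ - Y` is not positive definite. So it suffices to bound `f X - f Z + c ‖X - Z‖²` by
`K * logDetGap (X + S₂) Q` for all feasible `Z` (`SymMat.exists_errorBound`).

The matrix `Q` is chosen so that `X` satisfies the first-order conditions of the problem in which
`X + S₂` is replaced by `Q`, that is, of minimizing `-log det (Z + S₁) + lam log det (Z - X + Q)`.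
First-order conditions are sufficient for this nonconvex problem
(`Matrix.enhanced_objective_growth`): the multipliers of `0 ⪯ Z` and `Z ⪯ C` can be absorbed into
the offsets, which is the channel enhancement of Weingarten, Steinberg and Shamai. The enhanced
objective minorizes the given one by submodularity of `log det`, agrees with it at `X`, has `X` as
an unconstrained stationary point, and strong concavity of `log det` shows that it grows
quadratically away from `X`. If `logDetGap (X + S₂) Q` is small, then `Q` and `X + S₂` are
comparable in the Loewner order, the increments of the two objectives from `Z` to `X` differ by at
most a quantity of order `‖X + S₂ - Q‖ (‖X + S₂ - Q‖ + ‖X - Z‖)`, and `‖X + S₂ - Q‖²` is at most a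
constant times the gap; if the gap is not small, boundedness of `f` suffices
(`Matrix.exists_errorBound_of_posDef`).

Multipliers exist when `C` is invertible. As the constants depend on `C` only through a bound on
its trace, the singular case follows by replacing `C` by `C + ε`, projecting `X + Y` onto the
larger order interval and letting `ε` tend to zero (`SymMat.exists_normal_approximation`).

A global minimizer satisfies the first-order conditions with zero gap, so the error bound gives
quadratic growth at it, hence uniqueness. For a DCA step from `X` to `X'` the first-order
conditions at `X'` hold with `Q = X + S₂`, and `lam` times the gap is the amount by which the step
is guaranteed to decrease `f`; this is the linear rate, and quadratic growth turns it into
convergence of the iterates.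
-/

/-! ### Simultaneous diagonalization, the Frobenius norm, and the scalar logarithm -/

namespace Matrix
open scoped Matrix.Norms.Frobenius
variable {ι : Type*} [Fintype ι] [DecidableEq ι]

theorem PosSemidef.exists_eq_conjTranspose_mul_self {A : Matrix ι ι ℝ} (hA : A.PosSemidef) :
    ∃ F : Matrix ι ι ℝ, A = Fᴴ * F := by
  open scoped MatrixOrder in
  exact CStarAlgebra.nonneg_iff_eq_star_mul_self.1 (nonneg_iff_posSemidef.2 hA)

/-- A positive definite matrix and a Hermitian matrix are diagonal in a common basis, which is
orthonormal for the first one. -/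
theorem PosDef.exists_simultaneous_diagonal {A B : Matrix ι ι ℝ} (hA : A.PosDef)
    (hB : B.IsHermitian) : ∃ (N : Matrix ι ι ℝ) (u : ι → ℝ), IsUnit N.det ∧
      A = N * Nᴴ ∧ B = N * diagonal u * Nᴴ := by
  obtain ⟨F, rfl⟩ := hA.posSemidef.exists_eq_conjTranspose_mul_self
  have hF : IsUnit F.det := by
    have := hA.det_pos.ne'
    rw [det_mul] at this
    exact isUnit_iff_ne_zero.2 (right_ne_zero_of_mul this)
  have hG : ((F⁻¹)ᴴ * B * F⁻¹).IsHermitian := isHermitian_conjTranspose_mul_mul _ hB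
  have hs := hG.spectral_theorem
  set U : Matrix ι ι ℝ := (hG.eigenvectorUnitary : Matrix ι ι ℝ) with hU
  have hUU : U * Uᴴ = 1 := Unitary.coe_mul_star_self hG.eigenvectorUnitary
  have hUd : IsUnit U.det := by
    have : U.det * Uᴴ.det = 1 := by rw [← det_mul, hUU, det_one]
    exact IsUnit.of_mul_eq_one _ this
  rw [Unitary.conjStarAlgAut_apply] at hs
  refine ⟨Fᴴ * U, hG.eigenvalues, ?_, ?_, ?_⟩
  · rw [det_mul, det_conjTranspose]
    exact (hF.star).mul hUd
  · rw [conjTranspose_mul, conjTranspose_conjTranspose]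
    calc Fᴴ * F = Fᴴ * (U * Uᴴ) * F := by rw [hUU, mul_one]
      _ = _ := by simp only [Matrix.mul_assoc]
  · have h2 : B = Fᴴ * ((F⁻¹)ᴴ * B * F⁻¹) * F := by
      have h3 : Fᴴ * (F⁻¹)ᴴ = 1 := by
        rw [← conjTranspose_mul, nonsing_inv_mul _ hF, conjTranspose_one]
      calc B = (Fᴴ * (F⁻¹)ᴴ) * B * (F⁻¹ * F) := by
            rw [h3, nonsing_inv_mul _ hF, one_mul, mul_one]
        _ = _ := by simp only [Matrix.mul_assoc]
    rw [conjTranspose_mul, conjTranspose_conjTranspose]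
    calc B = Fᴴ * ((F⁻¹)ᴴ * B * F⁻¹) * F := h2
      _ = Fᴴ * (U * diagonal hG.eigenvalues * Uᴴ) * F := by
        conv_lhs => rw [hs]
        rfl
      _ = _ := by simp only [Matrix.mul_assoc]

theorem det_congr_diagonal (N : Matrix ι ι ℝ) (u : ι → ℝ) :
    (N * diagonal u * Nᴴ).det = N.det ^ 2 * ∏ i, u i := by
  rw [det_mul, det_mul, det_conjTranspose, det_diagonal, star_trivial]
  ring

theorem log_det_congr_diagonal {N : Matrix ι ι ℝ} (hN : IsUnit N.det) {u : ι → ℝ}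
    (hu : ∀ i, 0 < u i) : Real.log (N * diagonal u * Nᴴ).det =
      Real.log (N.det ^ 2) + ∑ i, Real.log (u i) := by
  rw [det_congr_diagonal, Real.log_mul (pow_ne_zero 2 hN.ne_zero)
    (Finset.prod_ne_zero_iff.2 fun i _ => (hu i).ne'), Real.log_prod fun i _ => (hu i).ne']

theorem posDef_congr_diagonal {N : Matrix ι ι ℝ} (hN : IsUnit N.det) {u : ι → ℝ} :
    (N * diagonal u * Nᴴ).PosDef ↔ ∀ i, 0 < u i := by
  rw [← posDef_diagonal_iff]
  exact IsUnit.posDef_star_right_conjugate_iff ((isUnit_iff_isUnit_det _).2 hN)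

theorem posSemidef_congr_diagonal {N : Matrix ι ι ℝ} (hN : IsUnit N.det) {u : ι → ℝ} :
    (N * diagonal u * Nᴴ).PosSemidef ↔ ∀ i, 0 ≤ u i := by
  rw [← posSemidef_diagonal_iff]
  exact IsUnit.posSemidef_star_right_conjugate_iff ((isUnit_iff_isUnit_det _).2 hN)

theorem inv_congr_diagonal {N : Matrix ι ι ℝ} (hN : IsUnit N.det) {u : ι → ℝ}
    (hu : ∀ i, u i ≠ 0) :
    (N * diagonal u * Nᴴ)⁻¹ = (N⁻¹)ᴴ * diagonal (fun i => (u i)⁻¹) * N⁻¹ := by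
  refine inv_eq_right_inv ?_
  have h3 : Nᴴ * (N⁻¹)ᴴ = 1 := by
    rw [← conjTranspose_mul, nonsing_inv_mul _ hN, conjTranspose_one]
  calc N * diagonal u * Nᴴ * ((N⁻¹)ᴴ * diagonal (fun i => (u i)⁻¹) * N⁻¹)
      = N * (diagonal u * (Nᴴ * (N⁻¹)ᴴ) * diagonal (fun i => (u i)⁻¹)) * N⁻¹ := by
        simp only [Matrix.mul_assoc]
    _ = 1 := by
        rw [h3, mul_one, diagonal_mul_diagonal]
        simp [hu, mul_nonsing_inv _ hN]

theorem trace_inv_mul_congr_diagonal {N : Matrix ι ι ℝ} (hN : IsUnit N.det) {u v : ι → ℝ}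
    (hu : ∀ i, u i ≠ 0) :
    ((N * diagonal u * Nᴴ)⁻¹ * (N * diagonal v * Nᴴ)).trace = ∑ i, v i / u i := by
  rw [inv_congr_diagonal hN hu, trace_mul_comm]
  have h3 : Nᴴ * (N⁻¹)ᴴ = 1 := by
    rw [← conjTranspose_mul, nonsing_inv_mul _ hN, conjTranspose_one]
  have : N * diagonal v * Nᴴ * ((N⁻¹)ᴴ * diagonal (fun i => (u i)⁻¹) * N⁻¹)
      = N * (diagonal v * (Nᴴ * (N⁻¹)ᴴ) * diagonal (fun i => (u i)⁻¹)) * N⁻¹ := by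
        simp only [Matrix.mul_assoc]
  rw [this, h3, mul_one, diagonal_mul_diagonal, trace_mul_comm, ← Matrix.mul_assoc,
    nonsing_inv_mul _ hN, one_mul, trace_diagonal]
  simp [div_eq_mul_inv]

theorem frobenius_norm_sq (A : Matrix ι ι ℝ) : ‖A‖ ^ 2 = (A * Aᴴ).trace := by
  rw [frobenius_norm_def, ← Real.sqrt_eq_rpow, Real.sq_sqrt (by positivity)]
  simp [trace, mul_apply, sq]

theorem PosSemidef.frobenius_norm_le_trace {A : Matrix ι ι ℝ} (hA : A.PosSemidef) :
    ‖A‖ ≤ A.trace := by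
  obtain ⟨F, rfl⟩ := hA.exists_eq_conjTranspose_mul_self
  calc ‖Fᴴ * F‖ ≤ ‖Fᴴ‖ * ‖F‖ := frobenius_norm_mul _ _
    _ = (Fᴴ * F).trace := by
      rw [frobenius_norm_conjTranspose, ← sq, frobenius_norm_sq, trace_mul_comm]

theorem abs_trace_mul_le (A B : Matrix ι ι ℝ) : |(A * B).trace| ≤ ‖A‖ * ‖B‖ := by
  rw [← sq_le_sq₀ (abs_nonneg _) (by positivity), sq_abs, mul_pow,
    ← frobenius_norm_conjTranspose B, frobenius_norm_sq, frobenius_norm_sq]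
  simp only [trace, mul_apply, diag_apply, ← Finset.sum_product', Finset.univ_product_univ]
  have := Finset.sum_mul_sq_le_sq_mul_sq Finset.univ (fun p : ι × ι => A p.1 p.2)
    (fun p : ι × ι => B p.2 p.1)
  simpa [sq] using this

/-- Only the trace of `N Nᴴ` enters, not the condition number of `N`; the constants of the error
bound are uniform in the feasible point because of this. -/
theorem frobenius_norm_congr_diagonal_sq_le (N : Matrix ι ι ℝ) (v : ι → ℝ) :
    ‖N * diagonal v * Nᴴ‖ ^ 2 ≤ (N * Nᴴ).trace ^ 2 * ∑ i, v i ^ 2 := by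
  have h1 : ‖N * diagonal v * Nᴴ‖ ≤ ‖N‖ * ‖(diagonal v : Matrix ι ι ℝ)‖ * ‖N‖ := by
    refine (frobenius_norm_mul _ _).trans ?_
    rw [frobenius_norm_conjTranspose]
    gcongr
    exact frobenius_norm_mul _ _
  have h2 : ‖(diagonal v : Matrix ι ι ℝ)‖ ^ 2 = ∑ i, v i ^ 2 := by
    rw [frobenius_norm_diagonal, EuclideanSpace.norm_eq, Real.sq_sqrt (by positivity)]
    simp
  calc _ ≤ (‖N‖ * ‖(diagonal v : Matrix ι ι ℝ)‖ * ‖N‖) ^ 2 := by gcongr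
    _ = _ := by rw [← h2, ← frobenius_norm_sq]; ring

end Matrix

/-- The second derivative of the logarithm is at most `-1` on `(0, 1]`. -/
theorem log_le_tangent_sub_sq {x m : ℝ} (hx : 0 < x) (hx1 : x ≤ 1) (hm : 0 < m) (hm1 : m ≤ 1) :
    Real.log x ≤ Real.log m + (x - m) / m - (x - m) ^ 2 / 2 := by
  set F : ℝ → ℝ := fun z => Real.log m + (z - m) / m - (z - m) ^ 2 / 2 - Real.log z with hF
  have hd : ∀ z, 0 < z → HasDerivAt F ((z - m) * (1 - z * m) / (z * m)) z := by
    intro z hz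
    have := (((((hasDerivAt_id z).sub_const m).div_const m).const_add (Real.log m)).sub
      ((((hasDerivAt_id z).sub_const m).pow 2).div_const 2)).sub (Real.hasDerivAt_log hz.ne')
    refine HasDerivAt.congr_deriv (f := F) this ?_
    simp only [id]
    field_simp
    ring
  have hFm : F m = 0 := by simp [hF]
  suffices 0 ≤ F x by simp only [hF] at this; linarith
  rcases le_total m x with h | h
  · have hmono : MonotoneOn F (Set.Icc m 1) := by
      refine monotoneOn_of_deriv_nonneg (convex_Icc _ _)
        (fun z hz => (hd z (hm.trans_le hz.1)).continuousAt.continuousWithinAt)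
        (fun z hz => ?_) (fun z hz => ?_)
      · rw [interior_Icc] at hz
        exact (hd z (hm.trans hz.1)).differentiableAt.differentiableWithinAt
      · rw [interior_Icc] at hz
        have hz0 : 0 < z := hm.trans hz.1
        rw [(hd z hz0).deriv]
        have h1 : 0 ≤ z - m := by linarith [hz.1]
        have h2 : 0 ≤ 1 - z * m := by nlinarith [hz.2]
        positivity
    rw [← hFm]
    exact hmono ⟨le_rfl, hm1⟩ ⟨h, hx1⟩ h
  · have hanti : AntitoneOn F (Set.Icc x m) := by
      refine antitoneOn_of_deriv_nonpos (convex_Icc _ _)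
        (fun z hz => (hd z (hx.trans_le hz.1)).continuousAt.continuousWithinAt)
        (fun z hz => ?_) (fun z hz => ?_)
      · rw [interior_Icc] at hz
        exact (hd z (hx.trans hz.1)).differentiableAt.differentiableWithinAt
      · rw [interior_Icc] at hz
        have hz0 : 0 < z := hx.trans hz.1
        rw [(hd z hz0).deriv]
        have h1 : z - m ≤ 0 := by linarith [hz.2]
        have h2 : 0 ≤ 1 - z * m := by nlinarith [hz.2]
        exact div_nonpos_of_nonpos_of_nonneg (mul_nonpos_of_nonpos_of_nonneg h1 h2) (by positivity)
    rw [← hFm]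
    exact hanti ⟨le_rfl, h⟩ ⟨h, le_rfl⟩ h

theorem log_strongConcave {x y lam : ℝ} (hx : 0 < x) (hx1 : x ≤ 1) (hy : 0 < y) (hy1 : y ≤ 1)
    (hl : 1 < lam) : Real.log x + (lam - 1) * Real.log y + (lam - 1) / (2 * lam) * (x - y) ^ 2 ≤
      lam * Real.log ((x + (lam - 1) * y) / lam) := by
  have hl0 : 0 < lam := by linarith
  set m := (x + (lam - 1) * y) / lam with hm
  have hmul : lam * m = x + (lam - 1) * y := by rw [hm]; field_simp
  have hm0 : 0 < m := by
    have : 0 < (lam - 1) * y := mul_pos (by linarith) hy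
    positivity
  have hm1 : m ≤ 1 := by
    rw [hm, div_le_one hl0]; nlinarith
  have h1 := log_le_tangent_sub_sq hx hx1 hm0 hm1
  have h2 := log_le_tangent_sub_sq hy hy1 hm0 hm1
  have h3 := mul_le_mul_of_nonneg_left h2 (by linarith : 0 ≤ lam - 1)
  have e1 : (x - m) / m + (lam - 1) * ((y - m) / m) = 0 := by
    field_simp; linarith
  have e2 : (x - m) ^ 2 / 2 + (lam - 1) * ((y - m) ^ 2 / 2) =
      (lam - 1) / (2 * lam) * (x - y) ^ 2 := by
    rw [hm]; field_simp; ring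
  nlinarith

/-! ### The Bregman distance, strong concavity and submodularity of `log det` -/

namespace Matrix
open scoped Matrix.Norms.Frobenius
variable {ι : Type*} [Fintype ι] [DecidableEq ι]

/-- Two positive definite matrices, diagonalized relative to their sum: their eigenvalues then lie
in `(0, 1)`, where the logarithm is strongly concave with an absolute constant. -/
theorem PosDef.exists_diagonal_relative_to_add {A B : Matrix ι ι ℝ} (hA : A.PosDef)
    (hB : B.PosDef) : ∃ (M : Matrix ι ι ℝ) (v : ι → ℝ), IsUnit M.det ∧ (∀ i, |v i| < 1) ∧
      A + B = M * Mᴴ ∧ A - B = M * diagonal v * Mᴴ ∧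
      A = M * diagonal (fun i => (1 + v i) / 2) * Mᴴ ∧
      B = M * diagonal (fun i => (1 - v i) / 2) * Mᴴ := by
  obtain ⟨M, v, hM, h1, h2⟩ := (hA.add hB).exists_simultaneous_diagonal
    (hA.isHermitian.sub hB.isHermitian)
  have hd1 : (diagonal (fun i => (1 + v i) / 2) : Matrix ι ι ℝ) =
      (1 / 2 : ℝ) • (1 + diagonal v) := by
    rw [← diagonal_one, diagonal_add, ← diagonal_smul]
    congr 1; ext i; simp; ring
  have hd2 : (diagonal (fun i => (1 - v i) / 2) : Matrix ι ι ℝ) =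
      (1 / 2 : ℝ) • (1 - diagonal v) := by
    rw [← diagonal_one, diagonal_sub, ← diagonal_smul]
    congr 1; ext i; simp; ring
  have hA' : A = M * diagonal (fun i => (1 + v i) / 2) * Mᴴ := by
    rw [hd1, Matrix.mul_smul, Matrix.smul_mul, mul_add, mul_one, add_mul, ← h1, ← h2]
    simp [← two_smul ℝ A, smul_smul]
  have hB' : B = M * diagonal (fun i => (1 - v i) / 2) * Mᴴ := by
    rw [hd2, Matrix.mul_smul, Matrix.smul_mul, mul_sub, mul_one, sub_mul, ← h1, ← h2]
    simp [← two_smul ℝ B, smul_smul]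
  refine ⟨M, v, hM, fun i => ?_, h1, h2, hA', hB'⟩
  rw [hA', posDef_congr_diagonal hM] at hA
  rw [hB', posDef_congr_diagonal hM] at hB
  exact abs_lt.2 ⟨by linarith [hA i], by linarith [hB i]⟩

/-- The Bregman distance from `B` to `A` generated by `-log det`. -/
noncomputable def logDetGap (A B : Matrix ι ι ℝ) : ℝ :=
  Real.log B.det + (B⁻¹ * (A - B)).trace - Real.log A.det

theorem logDetGap_self (A : Matrix ι ι ℝ) : logDetGap A A = 0 := by simp [logDetGap]

theorem sum_sq_le_logDetGap {M : Matrix ι ι ℝ} {v : ι → ℝ} (hM : IsUnit M.det)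
    (hv : ∀ i, |v i| < 1) : ∑ i, v i ^ 2 ≤
      2 * logDetGap (M * diagonal (fun i => (1 + v i) / 2) * Mᴴ)
        (M * diagonal (fun i => (1 - v i) / 2) * Mᴴ) := by
  have hv1 : ∀ i, 0 < (1 + v i) / 2 := fun i => by linarith [(abs_lt.1 (hv i)).1]
  have hv2 : ∀ i, 0 < (1 - v i) / 2 := fun i => by linarith [(abs_lt.1 (hv i)).2]
  rw [logDetGap, log_det_congr_diagonal hM hv1, log_det_congr_diagonal hM hv2, ← sub_mul, ← mul_sub,
    diagonal_sub, trace_inv_mul_congr_diagonal hM fun i => (hv2 i).ne']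
  have : ∑ i, v i ^ 2 ≤ ∑ i, 2 * (Real.log ((1 - v i) / 2) +
      ((1 + v i) / 2 - (1 - v i) / 2) / ((1 - v i) / 2) - Real.log ((1 + v i) / 2)) := by
    refine Finset.sum_le_sum fun i _ => ?_
    have := log_le_tangent_sub_sq (hv1 i) (by linarith [hv2 i]) (hv2 i) (by linarith [hv1 i])
    have e : (1 + v i) / 2 - (1 - v i) / 2 = v i := by ring
    rw [e] at this ⊢
    linarith
  rw [← Finset.mul_sum, Finset.sum_sub_distrib, Finset.sum_add_distrib] at this
  linarith

theorem PosDef.norm_sub_sq_le_logDetGap {A B : Matrix ι ι ℝ} (hA : A.PosDef) (hB : B.PosDef) :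
    ‖A - B‖ ^ 2 ≤ 2 * (A + B).trace ^ 2 * logDetGap A B := by
  obtain ⟨M, v, hM, hv, h1, h2, h3, h4⟩ := hA.exists_diagonal_relative_to_add hB
  have := sum_sq_le_logDetGap hM hv
  rw [← h3, ← h4] at this
  calc _ ≤ (A + B).trace ^ 2 * ∑ i, v i ^ 2 := by
        rw [h1, h2]; exact frobenius_norm_congr_diagonal_sq_le M v
    _ ≤ (A + B).trace ^ 2 * (2 * logDetGap A B) := by gcongr
    _ = _ := by ring

theorem PosDef.logDetGap_nonneg {A B : Matrix ι ι ℝ} (hA : A.PosDef) (hB : B.PosDef) :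
    0 ≤ logDetGap A B := by
  obtain ⟨M, v, hM, hv, h1, h2, h3, h4⟩ := hA.exists_diagonal_relative_to_add hB
  have := sum_sq_le_logDetGap hM hv
  rw [← h3, ← h4] at this
  have : 0 ≤ ∑ i, v i ^ 2 := by positivity
  linarith

/-- A small Bregman distance forces the two matrices to be comparable in the Loewner order. -/
theorem PosDef.comparable_of_logDetGap_lt {A B : Matrix ι ι ℝ} (hA : A.PosDef) (hB : B.PosDef)
    (h : logDetGap A B < 1 / 8) :
    ((3 : ℝ) • A - B).PosSemidef ∧ ((3 : ℝ) • B - A).PosSemidef := by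
  obtain ⟨M, v, hM, hv, h1, h2, h3, h4⟩ := hA.exists_diagonal_relative_to_add hB
  have hs := sum_sq_le_logDetGap hM hv
  rw [← h3, ← h4] at hs
  have hv' : ∀ i, |v i| ≤ 1 / 2 := by
    intro i
    have := Finset.single_le_sum (fun j _ => sq_nonneg (v j)) (Finset.mem_univ i)
    refine abs_le_of_sq_le_sq ?_ (by norm_num)
    linarith
  constructor
  · rw [h3, h4, ← Matrix.smul_mul, ← Matrix.mul_smul, ← diagonal_smul, ← sub_mul, ← mul_sub,
      diagonal_sub, posSemidef_congr_diagonal hM]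
    intro i
    simp
    linarith [(abs_le.1 (hv' i)).1]
  · rw [h3, h4, ← Matrix.smul_mul, ← Matrix.mul_smul, ← diagonal_smul, ← sub_mul, ← mul_sub,
      diagonal_sub, posSemidef_congr_diagonal hM]
    intro i
    simp
    linarith [(abs_le.1 (hv' i)).2]

/-- Strong concavity of `log det` at the point `lam⁻¹ T + (1 - lam⁻¹) P` of a segment. -/
theorem PosDef.log_det_strongConcave {T P : Matrix ι ι ℝ} (hT : T.PosDef) (hP : P.PosDef)
    {lam : ℝ} (hl : 1 < lam) :
    0 ≤ lam * (Real.log (T + (lam - 1) • P).det - Real.log (lam • P).det)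
        - Real.log T.det + Real.log P.det ∧
    (lam - 1) / (2 * lam) * ‖T - P‖ ^ 2 ≤ (T + P).trace ^ 2 *
      (lam * (Real.log (T + (lam - 1) • P).det - Real.log (lam • P).det)
        - Real.log T.det + Real.log P.det) := by
  obtain ⟨M, v, hM, hv, h1, h2, h3, h4⟩ := hT.exists_diagonal_relative_to_add hP
  have hv1 : ∀ i, 0 < (1 + v i) / 2 := fun i => by linarith [(abs_lt.1 (hv i)).1]
  have hv2 : ∀ i, 0 < (1 - v i) / 2 := fun i => by linarith [(abs_lt.1 (hv i)).2]
  have hl0 : 0 < lam := by linarith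
  have hv3 : ∀ i, 0 < (1 + v i) / 2 + (lam - 1) * ((1 - v i) / 2) := fun i =>
    add_pos (hv1 i) (mul_pos (by linarith) (hv2 i))
  have e1 : T + (lam - 1) • P =
      M * diagonal (fun i => (1 + v i) / 2 + (lam - 1) * ((1 - v i) / 2)) * Mᴴ := by
    rw [h3, h4, ← Matrix.smul_mul, ← Matrix.mul_smul, ← diagonal_smul, ← add_mul, ← mul_add,
      diagonal_add]
    rfl
  have e2 : lam • P = M * diagonal (fun i => lam * ((1 - v i) / 2)) * Mᴴ := by
    rw [h4, ← Matrix.smul_mul, ← Matrix.mul_smul, ← diagonal_smul]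
    rfl
  have key : (lam - 1) / (2 * lam) * ∑ i, v i ^ 2 ≤
      lam * (Real.log (T + (lam - 1) • P).det - Real.log (lam • P).det)
        - Real.log T.det + Real.log P.det := by
    rw [e1, e2, h3, h4, log_det_congr_diagonal hM hv1, log_det_congr_diagonal hM hv2,
      log_det_congr_diagonal hM hv3,
      log_det_congr_diagonal hM (fun i => mul_pos hl0 (hv2 i))]
    have : ∑ i, (lam - 1) / (2 * lam) * v i ^ 2 ≤ ∑ i,
        (lam * (Real.log ((1 + v i) / 2 + (lam - 1) * ((1 - v i) / 2)) -
          Real.log (lam * ((1 - v i) / 2))) -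
          Real.log ((1 + v i) / 2) + Real.log ((1 - v i) / 2)) := by
      refine Finset.sum_le_sum fun i _ => ?_
      have := log_strongConcave (hv1 i) (by linarith [hv2 i]) (hv2 i) (by linarith [hv1 i]) hl
      have e : (1 + v i) / 2 - (1 - v i) / 2 = v i := by ring
      rw [e, Real.log_div (hv3 i).ne' hl0.ne'] at this
      rw [Real.log_mul hl0.ne' (hv2 i).ne']
      linarith
    rw [Finset.sum_add_distrib, Finset.sum_sub_distrib, ← Finset.mul_sum,
      ← Finset.mul_sum, Finset.sum_sub_distrib] at this
    linarith
  have hlc : 0 ≤ (lam - 1) / (2 * lam) := div_nonneg (by linarith) (by linarith)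
  refine ⟨le_trans (by positivity) key, ?_⟩
  calc _ ≤ (lam - 1) / (2 * lam) * ((T + P).trace ^ 2 * ∑ i, v i ^ 2) := by
        gcongr
        rw [h1, h2]; exact frobenius_norm_congr_diagonal_sq_le M v
    _ = (T + P).trace ^ 2 * ((lam - 1) / (2 * lam) * ∑ i, v i ^ 2) := by ring
    _ ≤ _ := by gcongr

theorem PosDef.of_le {κ : Type*} {A B : Matrix κ κ ℝ} (hA : A.PosDef) (h : (B - A).PosSemidef) :
    B.PosDef := by
  simpa using hA.add_posSemidef h

theorem PosDef.inv_sub_inv_posSemidef {A B : Matrix ι ι ℝ} (hA : A.PosDef)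
    (h : (B - A).PosSemidef) : (A⁻¹ - B⁻¹).PosSemidef := by
  have hB := hA.of_le h
  obtain ⟨N, u, hN, h1, h2⟩ := hA.exists_simultaneous_diagonal hB.isHermitian
  have h1' : A = N * diagonal (fun _ => (1 : ℝ)) * Nᴴ := by rw [diagonal_one, mul_one, h1]
  rw [h1', h2, ← sub_mul, ← mul_sub, diagonal_sub, posSemidef_congr_diagonal hN] at h
  rw [h1', h2, inv_congr_diagonal hN (by simp), inv_congr_diagonal hN
    (fun i => by linarith [h i]), ← sub_mul, ← mul_sub, diagonal_sub]
  have : (diagonal fun i => (1 : ℝ)⁻¹ - (u i)⁻¹).PosSemidef := by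
    rw [posSemidef_diagonal_iff]
    intro i
    have := h i
    rw [inv_one, sub_nonneg]
    exact inv_le_one_of_one_le₀ (by linarith)
  exact this.conjTranspose_mul_mul_same _

theorem PosDef.det_le_det {A B : Matrix ι ι ℝ} (hA : A.PosDef)
    (h : (B - A).PosSemidef) : A.det ≤ B.det := by
  have hB := hA.of_le h
  obtain ⟨N, u, hN, h1, h2⟩ := hA.exists_simultaneous_diagonal hB.isHermitian
  have h1' : A = N * diagonal (fun _ => (1 : ℝ)) * Nᴴ := by rw [diagonal_one, mul_one, h1]
  rw [h1', h2, ← sub_mul, ← mul_sub, diagonal_sub, posSemidef_congr_diagonal hN] at h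
  rw [h1', h2, det_congr_diagonal, det_congr_diagonal]
  gcongr with i
  linarith [h i]

theorem PosDef.det_add_mul_det_le {A B Z : Matrix ι ι ℝ} (hA : A.PosDef)
    (h : (B - A).PosSemidef) (hZ : Z.PosSemidef) :
    (B + Z).det * A.det ≤ B.det * (A + Z).det := by
  -- by the Weinstein–Aronszajn identity the two ratios of determinants are
  -- `det (1 + F (A + Z)⁻¹ Fᴴ)` and `det (1 + F A⁻¹ Fᴴ)`, where `B - A = Fᴴ F`
  obtain ⟨F, hF⟩ := h.exists_eq_conjTranspose_mul_self
  have hB : B = A + Fᴴ * F := by rw [← hF]; abel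
  have hAZ := hA.add_posSemidef hZ
  have key : ∀ {D : Matrix ι ι ℝ}, D.PosDef →
      (D + Fᴴ * F).det = D.det * (1 + F * D⁻¹ * Fᴴ).det := by
    intro D hD
    have hu : IsUnit D.det := isUnit_iff_ne_zero.2 hD.det_pos.ne'
    rw [Matrix.mul_assoc, det_one_add_mul_comm, ← det_mul, mul_add, mul_one, ← Matrix.mul_assoc,
      ← Matrix.mul_assoc, mul_nonsing_inv _ hu, one_mul]
  have e : B + Z = (A + Z) + Fᴴ * F := by rw [hB]; abel
  rw [e, key hAZ, hB, key hA]
  have hP : (1 + F * (A + Z)⁻¹ * Fᴴ).PosDef :=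
    PosDef.one.add_posSemidef (hAZ.inv.posSemidef.mul_mul_conjTranspose_same F)
  have hle : (1 + F * (A + Z)⁻¹ * Fᴴ).det ≤ (1 + F * A⁻¹ * Fᴴ).det := by
    refine hP.det_le_det ?_
    have h2 := (hA.inv_sub_inv_posSemidef (B := A + Z)
      (by simpa using hZ)).mul_mul_conjTranspose_same F
    convert h2 using 1
    rw [mul_sub, sub_mul]; abel
  have := mul_le_mul_of_nonneg_left hle (mul_pos hA.det_pos hAZ.det_pos).le
  linarith

/-- The increment of `log det` caused by adding `Z` is smaller at a larger matrix. -/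
theorem PosDef.log_det_submodular {A B Z : Matrix ι ι ℝ} (hA : A.PosDef)
    (h : (B - A).PosSemidef) (hZ : Z.PosSemidef) :
    Real.log (B + Z).det + Real.log A.det ≤ Real.log B.det + Real.log (A + Z).det := by
  have hB := hA.of_le h
  have h1 := hA.det_pos
  have h2 := hB.det_pos
  have h3 := (hA.add_posSemidef hZ).det_pos
  have h4 := (hB.add_posSemidef hZ).det_pos
  rw [← Real.log_mul h4.ne' h1.ne', ← Real.log_mul h2.ne' h3.ne']
  exact Real.log_le_log (by positivity) (hA.det_add_mul_det_le h hZ)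

end Matrix

/-! ### Sufficiency of the first-order conditions -/

namespace Matrix
open scoped Matrix.Norms.Frobenius
variable {ι : Type*} [Fintype ι] [DecidableEq ι]

theorem PosSemidef.mul_eq_zero_of_trace_nonpos {X A : Matrix ι ι ℝ} (hX : X.PosSemidef)
    (hA : A.PosSemidef) (h : (X * A).trace ≤ 0) : X * A = 0 := by
  obtain ⟨F, rfl⟩ := hA.exists_eq_conjTranspose_mul_self
  obtain ⟨G, rfl⟩ := hX.exists_eq_conjTranspose_mul_self
  have e : (Gᴴ * G * (Fᴴ * F)).trace = ‖G * Fᴴ‖ ^ 2 := by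
    rw [frobenius_norm_sq, conjTranspose_mul, conjTranspose_conjTranspose, Matrix.mul_assoc,
      trace_mul_comm]
    simp only [Matrix.mul_assoc]
  rw [e] at h
  have h0 : G * Fᴴ = 0 :=
    norm_eq_zero.1 (pow_eq_zero_iff two_ne_zero |>.1 (le_antisymm h (sq_nonneg _)))
  calc _ = Gᴴ * (G * Fᴴ) * F := by simp only [Matrix.mul_assoc]
    _ = 0 := by rw [h0]; simp

theorem PosSemidef.trace_mul_nonneg {X A : Matrix ι ι ℝ} (hX : X.PosSemidef)
    (hA : A.PosSemidef) : 0 ≤ (X * A).trace := by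
  obtain ⟨F, rfl⟩ := hA.exists_eq_conjTranspose_mul_self
  rw [← Matrix.mul_assoc, trace_mul_comm, ← Matrix.mul_assoc]
  exact (hX.mul_mul_conjTranspose_same F).trace_nonneg

/-- A normal vector of the order interval `[0, C]` at `X` is a difference of multipliers of the two
constraints, each complementary to its slack. This needs `C` to be invertible: for singular `C` the
sum of the two normal cones may fail to be closed. -/
theorem PosDef.exists_normal_decomposition {C X Y : Matrix ι ι ℝ} (hC : C.PosDef)
    (hX : X.PosSemidef) (hCX : (C - X).PosSemidef) (hY : Y.IsHermitian)
    (h : ∀ Z : Matrix ι ι ℝ, Z.PosSemidef → (C - Z).PosSemidef → (Y * (Z - X)).trace ≤ 0) :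
    ∃ A B : Matrix ι ι ℝ, A.PosSemidef ∧ B.PosSemidef ∧ Y = B - A ∧ X * A = 0 ∧
      (C - X) * B = 0 := by
  obtain ⟨N, y, hN, hCN, hYN⟩ := hC.inv.exists_simultaneous_diagonal hY
  have hNN : N⁻¹ * N = 1 := nonsing_inv_mul _ hN
  have hNN' : N * N⁻¹ = 1 := mul_nonsing_inv _ hN
  have hNH : Nᴴ * (N⁻¹)ᴴ = 1 := by rw [← conjTranspose_mul, hNN, conjTranspose_one]
  have hNH' : (N⁻¹)ᴴ * Nᴴ = 1 := by rw [← conjTranspose_mul, hNN', conjTranspose_one]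
  have hCeq : C = (N⁻¹)ᴴ * N⁻¹ := by
    have hCu : IsUnit C.det := isUnit_iff_ne_zero.2 hC.det_pos.ne'
    have e : C⁻¹ * ((N⁻¹)ᴴ * N⁻¹) = 1 := by
      rw [hCN]
      calc N * Nᴴ * ((N⁻¹)ᴴ * N⁻¹) = N * (Nᴴ * (N⁻¹)ᴴ) * N⁻¹ := by simp only [Matrix.mul_assoc]
        _ = 1 := by rw [hNH, mul_one, hNN']
    calc C = C * (C⁻¹ * ((N⁻¹)ᴴ * N⁻¹)) := by rw [e, mul_one]
      _ = _ := by rw [← Matrix.mul_assoc, mul_nonsing_inv _ hCu, one_mul]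
  have hyp : Y = N * diagonal (fun i => max (y i) 0) * Nᴴ -
      N * diagonal (fun i => max (-y i) 0) * Nᴴ := by
    rw [← sub_mul, ← mul_sub, diagonal_sub, hYN]
    congr 3; ext i
    rcases le_total (y i) 0 with h | h <;> simp [h]
  have hA : (N * diagonal (fun i => max (-y i) 0) * Nᴴ).PosSemidef :=
    (posSemidef_congr_diagonal hN).2 fun i => le_max_right _ _
  have hB : (N * diagonal (fun i => max (y i) 0) * Nᴴ).PosSemidef :=
    (posSemidef_congr_diagonal hN).2 fun i => le_max_right _ _
  -- the test point is the projection onto the positive part of `Y`, in the coordinates where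
  -- `C` is the identity
  set p : ι → ℝ := fun i => if 0 < y i then 1 else 0 with hp
  have hp0 : ∀ i, 0 ≤ p i := fun i => by simp only [hp]; split_ifs <;> norm_num
  have hp1 : ∀ i, 0 ≤ 1 - p i := fun i => by simp only [hp]; split_ifs <;> norm_num
  have hZ := h ((N⁻¹)ᴴ * diagonal p * N⁻¹)
    ((PosSemidef.diagonal (Pi.le_def.2 hp0)).conjTranspose_mul_mul_same _) (by
      have : C - (N⁻¹)ᴴ * diagonal p * N⁻¹ = (N⁻¹)ᴴ * diagonal (fun i => 1 - p i) * N⁻¹ := by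
        rw [← diagonal_sub, mul_sub, sub_mul, diagonal_one, mul_one, ← hCeq]
      rw [this]
      exact (PosSemidef.diagonal (Pi.le_def.2 hp1)).conjTranspose_mul_mul_same _)
  -- all traces are computed against `Nᴴ X N`, whose diagonal plays the role of `x`
  have tr : ∀ (d : ι → ℝ) (V : Matrix ι ι ℝ),
      (V * (N * diagonal d * Nᴴ)).trace = ∑ i, d i * (Nᴴ * V * N) i i := by
    intro d V
    rw [← Matrix.mul_assoc, trace_mul_comm, ← Matrix.mul_assoc, ← Matrix.mul_assoc,
      trace_mul_comm]
    simp [trace, diagonal_mul]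
  have hZN : Nᴴ * ((N⁻¹)ᴴ * diagonal p * N⁻¹) * N = diagonal p := by
    calc _ = (Nᴴ * (N⁻¹)ᴴ) * diagonal p * (N⁻¹ * N) := by simp only [Matrix.mul_assoc]
      _ = _ := by rw [hNH, hNN, one_mul, mul_one]
  have hCN' : Nᴴ * C * N = 1 := by
    rw [hCeq]
    calc _ = (Nᴴ * (N⁻¹)ᴴ) * (N⁻¹ * N) := by simp only [Matrix.mul_assoc]
      _ = _ := by rw [hNH, hNN, one_mul]
  rw [trace_mul_comm, hYN, tr, mul_sub, sub_mul, hZN] at hZ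
  have hsum : (X * (N * diagonal (fun i => max (-y i) 0) * Nᴴ)).trace +
      ((C - X) * (N * diagonal (fun i => max (y i) 0) * Nᴴ)).trace ≤ 0 := by
    rw [tr, tr, ← Finset.sum_add_distrib, mul_sub, sub_mul, hCN']
    refine (Finset.sum_le_sum fun i _ => ?_).trans hZ
    simp only [sub_apply, one_apply_eq, diagonal_apply_eq, hp]
    split_ifs with hi
    · rw [max_eq_right (by linarith), max_eq_left hi.le]; linarith
    · rw [max_eq_left (by linarith), max_eq_right (by linarith)]; linarith
  have h1 := hX.trace_mul_nonneg hA
  have h2 := hCX.trace_mul_nonneg hB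
  exact ⟨_, _, hA, hB, hyp, hX.mul_eq_zero_of_trace_nonpos hA (by linarith),
    hCX.mul_eq_zero_of_trace_nonpos hB (by linarith)⟩

/-- Absorbing a multiplier `A` of the constraint `0 ⪯ X` into the offset `S`: the enhanced offset
`S'` is smaller, and `log det (X + S) - log det S` does not change at the point `X` itself. -/
theorem PosDef.exists_enhancement {S A X : Matrix ι ι ℝ} (hS : S.PosDef) (hA : A.PosSemidef)
    (hX : X.PosSemidef) (hXA : X * A = 0) :
    ∃ S' : Matrix ι ι ℝ, S'.PosDef ∧ (S - S').PosSemidef ∧ S'⁻¹ = S⁻¹ + A ∧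
      (X + S')⁻¹ = (X + S)⁻¹ + A ∧
      Real.log (X + S).det + Real.log S'.det = Real.log S.det + Real.log (X + S').det := by
  have hI : (S⁻¹ + A).PosDef := hS.inv.add_posSemidef hA
  have hXS : (X + S).PosDef := hS.posSemidef_add hX
  have uS : IsUnit S.det := isUnit_iff_ne_zero.2 hS.det_pos.ne'
  have uI : IsUnit (S⁻¹ + A).det := isUnit_iff_ne_zero.2 hI.det_pos.ne'
  have uXS : IsUnit (X + S).det := isUnit_iff_ne_zero.2 hXS.det_pos.ne'
  set S' := (S⁻¹ + A)⁻¹ with hS'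
  have hS'pd : S'.PosDef := hI.inv
  have e1 : S⁻¹ * S' = 1 - A * S' := by
    have : (S⁻¹ + A) * S' = 1 := mul_nonsing_inv _ uI
    rw [add_mul] at this
    exact eq_sub_of_add_eq this
  have e2 : (X + S) * S⁻¹ * S' = X + S' := by
    rw [add_mul, mul_nonsing_inv _ uS, add_mul, one_mul, Matrix.mul_assoc, e1, mul_sub,
      ← Matrix.mul_assoc, hXA, zero_mul, mul_one, sub_zero]
  have hXS' : (X + S').PosDef := hS'pd.posSemidef_add hX
  refine ⟨S', hS'pd, ?_, ?_, ?_, ?_⟩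
  · have := hS.inv.inv_sub_inv_posSemidef (B := S⁻¹ + A) (by simpa using hA)
    rwa [nonsing_inv_nonsing_inv _ uS] at this
  · exact nonsing_inv_nonsing_inv _ uI
  · refine inv_eq_left_inv ?_
    have e3 : (X + S)⁻¹ * (X + S') = S⁻¹ * S' := by
      rw [← e2, ← Matrix.mul_assoc, ← Matrix.mul_assoc, nonsing_inv_mul _ uXS, one_mul]
    have hAX : A * X = 0 := by
      have := congrArg Matrix.conjTranspose hXA
      rwa [conjTranspose_mul, hA.isHermitian.eq, hX.isHermitian.eq, conjTranspose_zero] at this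
    rw [add_mul, e3, e1, mul_add, hAX]
    abel
  · rw [← Real.log_mul hXS.det_pos.ne' hS'pd.det_pos.ne',
      ← Real.log_mul hS.det_pos.ne' hXS'.det_pos.ne']
    congr 1
    have := congrArg det e2
    rw [det_mul, det_mul] at this
    rw [← this]
    have h1 : S.det * S⁻¹.det = 1 := by rw [← det_mul, mul_nonsing_inv _ uS, det_one]
    linear_combination (-(X + S).det * S'.det) * h1

/-- If `X` satisfies the first-order conditions for minimizing `-log det (Z + S) + lam log det (Z -
X + Q)` over `0 ⪯ Z ⪯ C`, then it is a global minimizer, with quadratic growth. Absorbing the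
multiplier `A` into `S` and the multiplier `B` into `Q` gives offsets for which `X` is stationary
without constraints; by submodularity of `log det` the enhanced objective minorizes the original one
on the order interval, with equality at `X`; and it grows quadratically by strong concavity of `log
det`. -/
theorem enhanced_objective_growth {S Q A B C X Z : Matrix ι ι ℝ} {lam : ℝ} (hlam : 1 < lam)
    (hS : S.PosDef) (hQ : Q.PosDef) (hA : A.PosSemidef) (hB : B.PosSemidef)
    (hX : X.PosSemidef) (hCX : (C - X).PosSemidef) (hXA : X * A = 0) (hCB : (C - X) * B = 0)
    (hstat : lam • Q⁻¹ + B = (X + S)⁻¹ + A) (hZ : Z.PosSemidef) (hCZ : (C - Z).PosSemidef)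
    {β : ℝ} (hβ : 2 * (C.trace + S.trace) ≤ β) :
    (Z - X + Q).PosDef ∧
    (lam - 1) / (2 * lam) * ‖X - Z‖ ^ 2 ≤ β ^ 2 *
      (Real.log (X + S).det - Real.log (Z + S).det +
        lam * (Real.log (Z - X + Q).det - Real.log Q.det)) := by
  have hl0 : 0 < lam := by linarith
  obtain ⟨S', hS', hSS', -, hinv1, hdet1⟩ := hS.exists_enhancement hA hX hXA
  obtain ⟨Q', hQ', hQQ', hinv2, -, hdet2⟩ := hQ.exists_enhancement
    (hB.smul (inv_nonneg.2 hl0.le)) hCX (by rw [Matrix.mul_smul, hCB, smul_zero])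
  have hP : (X + S').PosDef := hS'.posSemidef_add hX
  have hT : (Z + S').PosDef := hS'.posSemidef_add hZ
  have uP : IsUnit (X + S').det := isUnit_iff_ne_zero.2 hP.det_pos.ne'
  have uQ' : IsUnit Q'.det := isUnit_iff_ne_zero.2 hQ'.det_pos.ne'
  have hQP : Q' = lam • (X + S') := by
    have e : Q'⁻¹ = lam⁻¹ • (X + S')⁻¹ := by
      rw [hinv2, hinv1, ← hstat, smul_add, smul_smul, inv_mul_cancel₀ hl0.ne', one_smul]
    have e2 : Q'⁻¹ * (lam • (X + S')) = 1 := by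
      rw [e, smul_mul_smul_comm, inv_mul_cancel₀ hl0.ne', nonsing_inv_mul _ uP, one_smul]
    calc Q' = Q' * (Q'⁻¹ * (lam • (X + S'))) := by rw [e2, mul_one]
      _ = _ := by rw [← Matrix.mul_assoc, mul_nonsing_inv _ uQ', one_mul]
  have e3 : Z - X + Q' = (Z + S') + (lam - 1) • (X + S') := by
    rw [hQP, sub_smul, one_smul]; abel
  have hZQ' : (Z - X + Q').PosDef := by
    rw [e3]
    exact hT.add (hP.smul (by linarith))
  have hZQ : (Z - X + Q).PosDef := hZQ'.of_le (by convert hQQ' using 1; abel)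
  refine ⟨hZQ, ?_⟩
  -- submodularity between `0` and `Z` for the offsets of the first term, and between `Z` and `C`
  -- for those of the second
  have h1 := hS'.log_det_submodular hSS' hZ
  have h2 := hZQ'.log_det_submodular (B := Z - X + Q) (Z := C - Z)
    (by convert hQQ' using 1; abel) hCZ
  have e4 : Z - X + Q + (C - Z) = C - X + Q := by abel
  have e5 : Z - X + Q' + (C - Z) = C - X + Q' := by abel
  rw [e4, e5] at h2
  obtain ⟨h0, h3⟩ := hT.log_det_strongConcave hP hlam
  rw [← e3, ← hQP] at h0 h3
  have e6 : (Z + S') - (X + S') = -(X - Z) := by abel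
  rw [e6, norm_neg] at h3
  have tr0 : 0 ≤ (Z + S' + (X + S')).trace := (hT.add hP).posSemidef.trace_nonneg
  have tr1 : (Z + S' + (X + S')).trace ≤ 2 * (C.trace + S.trace) := by
    have a1 := hCZ.trace_nonneg
    have a2 := hCX.trace_nonneg
    have a3 := hSS'.trace_nonneg
    simp only [trace_sub, trace_add] at *
    linarith
  have h4 : lam * (Real.log (Z - X + Q').det - Real.log Q'.det) - Real.log (Z + S').det +
      Real.log (X + S').det ≤ Real.log (X + S).det - Real.log (Z + S).det +
        lam * (Real.log (Z - X + Q).det - Real.log Q.det) := by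
    have : lam * (Real.log (Z - X + Q').det - Real.log Q'.det) ≤
        lam * (Real.log (Z - X + Q).det - Real.log Q.det) := by
      gcongr lam * ?_
      linarith
    rw [add_comm S Z, add_comm S' Z] at h1
    linarith
  refine h3.trans ?_
  gcongr
  exact tr1.trans hβ

/-- The second difference of `log det` over a parallelogram is quadratic in its sides `D` and `R -
Q`. No lower bound on `D + Q` enters. -/
theorem log_det_second_difference_le {R Q D : Matrix ι ι ℝ} (hR : R.PosDef) (hQ : Q.PosDef)
    (hR' : (D + R).PosDef) (hQ' : (D + Q).PosDef) :
    Real.log R.det - Real.log Q.det + Real.log (D + Q).det - Real.log (D + R).det ≤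
      ‖(D + R)⁻¹‖ * ‖Q⁻¹‖ * ((‖R - Q‖ + ‖D‖) * ‖R - Q‖) := by
  have h1 := hR.logDetGap_nonneg hQ
  have h2 := hQ'.logDetGap_nonneg hR'
  have e1 : D + Q - (D + R) = -(R - Q) := by abel
  rw [logDetGap] at h1 h2
  rw [e1] at h2
  have uQ : IsUnit Q.det := isUnit_iff_ne_zero.2 hQ.det_pos.ne'
  have uR' : IsUnit (D + R).det := isUnit_iff_ne_zero.2 hR'.det_pos.ne'
  have e2 : Q⁻¹ - (D + R)⁻¹ = (D + R)⁻¹ * ((R - Q) + D) * Q⁻¹ := by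
    have : (R - Q) + D = (D + R) - Q := by abel
    rw [this, mul_sub, sub_mul, nonsing_inv_mul _ uR', one_mul, Matrix.mul_assoc,
      mul_nonsing_inv _ uQ, mul_one]
  have e3 : (Q⁻¹ * (R - Q)).trace + ((D + R)⁻¹ * (-(R - Q))).trace =
      ((D + R)⁻¹ * ((R - Q) + D) * Q⁻¹ * (R - Q)).trace := by
    rw [← e2, sub_mul, trace_sub, Matrix.mul_neg, trace_neg]; ring
  calc _ ≤ ((D + R)⁻¹ * ((R - Q) + D) * Q⁻¹ * (R - Q)).trace := by linarith
    _ ≤ ‖(D + R)⁻¹ * ((R - Q) + D) * Q⁻¹‖ * ‖R - Q‖ := (le_abs_self _).trans (abs_trace_mul_le _ _)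
    _ ≤ ‖(D + R)⁻¹‖ * (‖R - Q‖ + ‖D‖) * ‖Q⁻¹‖ * ‖R - Q‖ := by
        gcongr
        refine (frobenius_norm_mul _ _).trans ?_
        gcongr
        refine (frobenius_norm_mul _ _).trans ?_
        gcongr
        exact norm_add_le _ _
    _ = _ := by ring

end Matrix

/-! ### The error bound for an invertible upper constraint -/

namespace Matrix
open scoped Matrix.Norms.Frobenius
variable {ι : Type*} [Fintype ι] [DecidableEq ι]

/-- The objective `-log det (X + S₁) + lam log det (X + S₂)`, as a function of a matrix. -/
noncomputable def logDetDiff (S₁ S₂ : Matrix ι ι ℝ) (lam : ℝ) (X : Matrix ι ι ℝ) : ℝ :=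
  -Real.log (X + S₁).det + lam * Real.log (X + S₂).det

theorem smul_inv_smul_inv {A : Matrix ι ι ℝ} (hA : A.PosDef) {c : ℝ} (hc : c ≠ 0) :
    c • (c • A⁻¹)⁻¹ = A := by
  have h : (c • A⁻¹)⁻¹ = c⁻¹ • A := by
    refine inv_eq_left_inv ?_
    rw [smul_mul_smul_comm, mul_nonsing_inv _ (isUnit_iff_ne_zero.2 hA.det_pos.ne'),
      inv_mul_cancel₀ hc, one_smul]
  rw [h, smul_smul, mul_inv_cancel₀ hc, one_smul]

theorem PosDef.norm_inv_le_trace_inv {S A : Matrix ι ι ℝ} (hS : S.PosDef)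
    (h : (A - S).PosSemidef) : ‖A⁻¹‖ ≤ S⁻¹.trace := by
  refine (hS.of_le h).inv.posSemidef.frobenius_norm_le_trace.trans ?_
  have := (hS.inv_sub_inv_posSemidef h).trace_nonneg
  rw [trace_sub] at this
  linarith

theorem PosDef.norm_inv_le_of_posSemidef_three_smul_sub {S Q : Matrix ι ι ℝ} (hS : S.PosDef)
    (h : ((3 : ℝ) • Q - S).PosSemidef) : ‖Q⁻¹‖ ≤ 3 * S⁻¹.trace := by
  have hle : (Q - (3 : ℝ)⁻¹ • S).PosSemidef := by
    convert h.smul (by norm_num : (0 : ℝ) ≤ 3⁻¹) using 1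
    rw [smul_sub, smul_smul]
    norm_num
  have h := (hS.smul (by norm_num : (0 : ℝ) < 3⁻¹)).norm_inv_le_trace_inv hle
  have hinv : ((3 : ℝ)⁻¹ • S)⁻¹ = (3 : ℝ) • S⁻¹ := by
    refine inv_eq_left_inv ?_
    rw [smul_mul_smul_comm, nonsing_inv_mul _ (isUnit_iff_ne_zero.2 hS.det_pos.ne')]
    norm_num
  rwa [hinv, trace_smul, smul_eq_mul] at h

theorem PosDef.log_det_sub_le {S X Z : Matrix ι ι ℝ} (hS : S.PosDef) (hX : X.PosSemidef)
    (hZ : Z.PosSemidef) : Real.log (Z + S).det - Real.log (X + S).det ≤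
      S⁻¹.trace * ‖X - Z‖ := by
  have h := (hS.posSemidef_add hZ).logDetGap_nonneg (hS.posSemidef_add hX)
  have e : Z + S - (X + S) = -(X - Z) := by abel
  rw [logDetGap, e] at h
  have h2 := (le_abs_self _).trans (abs_trace_mul_le (X + S)⁻¹ (-(X - Z)))
  rw [norm_neg] at h2
  have h3 := hS.norm_inv_le_trace_inv (A := X + S) (by simpa using hX)
  have : ‖(X + S)⁻¹‖ * ‖X - Z‖ ≤ S⁻¹.trace * ‖X - Z‖ := by gcongr
  linarith

theorem logDetDiff_sub_le {S₁ S₂ X Z : Matrix ι ι ℝ} {lam : ℝ} (hlam : 1 < lam)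
    (hS₁ : S₁.PosDef) (hS₂ : S₂.PosDef) (hX : X.PosSemidef) (hZ : Z.PosSemidef) :
    logDetDiff S₁ S₂ lam X - logDetDiff S₁ S₂ lam Z ≤
      (S₁⁻¹.trace + lam * S₂⁻¹.trace) * ‖X - Z‖ := by
  have h1 := hS₁.log_det_sub_le hX hZ
  have h2 := hS₂.log_det_sub_le hZ hX
  rw [norm_sub_rev] at h2
  have h3 := mul_le_mul_of_nonneg_left h2 (by linarith : 0 ≤ lam)
  simp only [logDetDiff]
  linarith

theorem norm_sub_le_of_feasible {C X Z : Matrix ι ι ℝ} (hX : X.PosSemidef)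
    (hCX : (C - X).PosSemidef) (hZ : Z.PosSemidef) (hCZ : (C - Z).PosSemidef) :
    ‖X - Z‖ ≤ 2 * C.trace := by
  have a1 := hCZ.trace_nonneg
  have a2 := hCX.trace_nonneg
  have := hX.frobenius_norm_le_trace
  have := hZ.frobenius_norm_le_trace
  have := norm_sub_le X Z
  simp only [trace_sub] at *
  linarith

/-- The error bound for invertible `C`. With `Q` in place of `X + S₂`, the point `X` satisfies the
first-order conditions with the normal vector `Y`, so `logDetGap (X + S₂) Q` measures the violation
of these conditions in the original problem. The constants depend on `C` only through a bound `t` on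
its trace. -/
theorem exists_errorBound_of_posDef {S₁ S₂ : Matrix ι ι ℝ} {lam : ℝ} (hlam : 1 < lam)
    (hS₁ : S₁.PosDef) (hS₂ : S₂.PosDef) {t : ℝ} (ht : 0 ≤ t) :
    ∃ c K : ℝ, 0 < c ∧ 0 < K ∧ ∀ C X Z Y Q : Matrix ι ι ℝ, C.PosDef → C.trace ≤ t →
      X.PosSemidef → (C - X).PosSemidef → Z.PosSemidef → (C - Z).PosSemidef → Y.IsHermitian →
      (∀ V : Matrix ι ι ℝ, V.PosSemidef → (C - V).PosSemidef → (Y * (V - X)).trace ≤ 0) →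
      Q.PosDef → lam • Q⁻¹ = (X + S₁)⁻¹ - Y →
      logDetDiff S₁ S₂ lam X - logDetDiff S₁ S₂ lam Z + c * ‖X - Z‖ ^ 2 ≤
        K * logDetGap (X + S₂) Q := by
  have hl0 : 0 < lam := by linarith
  have s1 := hS₁.posSemidef.trace_nonneg
  have s2 := hS₂.posSemidef.trace_nonneg
  have i1 := hS₁.inv.posSemidef.trace_nonneg
  have i2 := hS₂.inv.posSemidef.trace_nonneg
  -- `c₀` is the modulus of growth of the enhanced objective, `a` the constant in the bound on the
  -- second difference of `log det`, `K₁` serves small gaps and `K₂` large ones; `β` is raised by one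
  -- so that the empty matrix needs no separate treatment
  obtain ⟨β, hβ⟩ : ∃ x : ℝ, x = 2 * (t + S₁.trace) + 1 := ⟨_, rfl⟩
  have hβ0 : 0 < β := by rw [hβ]; positivity
  obtain ⟨c₀, hc₀⟩ : ∃ x : ℝ, x = (lam - 1) / (2 * lam) / β ^ 2 := ⟨_, rfl⟩
  have hc₀0 : 0 < c₀ := by
    have : 0 < lam - 1 := by linarith
    rw [hc₀]
    positivity
  obtain ⟨a, ha⟩ : ∃ x : ℝ, x = S₂⁻¹.trace * (3 * S₂⁻¹.trace) := ⟨_, rfl⟩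
  have ha0 : 0 ≤ a := by rw [ha]; positivity
  obtain ⟨K₁, hK₁⟩ : ∃ x : ℝ, x =
    (lam * a + (lam * a) ^ 2 / (2 * c₀)) * (2 * (4 * (t + S₂.trace)) ^ 2) := ⟨_, rfl⟩
  have hK₁0 : 0 ≤ K₁ := by rw [hK₁]; positivity
  obtain ⟨K₂, hK₂⟩ : ∃ x : ℝ, x =
    (S₁⁻¹.trace + lam * S₂⁻¹.trace) * (2 * t) + c₀ / 2 * (2 * t) ^ 2 := ⟨_, rfl⟩
  have hK₂0 : 0 ≤ K₂ := by rw [hK₂]; positivity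
  refine ⟨c₀ / 2, K₁ + 8 * K₂ + 1, by positivity, by positivity, ?_⟩
  intro C X Z Y Q hC hCt hX hCX hZ hCZ hY hN hQ hstat
  have hR : (X + S₂).PosDef := hS₂.posSemidef_add hX
  have hG := hR.logDetGap_nonneg hQ
  set G := logDetGap (X + S₂) Q with hGdef
  have hXt : ‖X - Z‖ ≤ 2 * t := (norm_sub_le_of_feasible hX hCX hZ hCZ).trans (by linarith)
  rcases lt_or_ge G (1 / 8) with hsmall | hlarge
  · obtain ⟨hQR, hRQ⟩ := hR.comparable_of_logDetGap_lt hQ hsmall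
    obtain ⟨A, B, hA, hB, hYAB, hXA, hCB⟩ := hC.exists_normal_decomposition hX hCX hY hN
    obtain ⟨hQ', hgrow⟩ := enhanced_objective_growth hlam hS₁ hQ hA hB hX hCX hXA hCB
      (by rw [hstat, hYAB]; abel) hZ hCZ (β := β) (by linarith)
    have hgrow' : c₀ * ‖X - Z‖ ^ 2 ≤ Real.log (X + S₁).det - Real.log (Z + S₁).det +
        lam * (Real.log (Z - X + Q).det - Real.log Q.det) := by
      rw [hc₀, div_mul_eq_mul_div, div_le_iff₀ (by positivity)]
      linarith
    have hZS : (Z - X) + (X + S₂) = Z + S₂ := by abel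
    have h2 := log_det_second_difference_le hR hQ (D := Z - X)
      (by rw [hZS]; exact hS₂.posSemidef_add hZ) hQ'
    rw [hZS] at h2
    have n1 : ‖(Z + S₂)⁻¹‖ ≤ S₂⁻¹.trace := hS₂.norm_inv_le_trace_inv (by simpa using hZ)
    have n2 : ‖Q⁻¹‖ ≤ 3 * S₂⁻¹.trace := by
      refine hS₂.norm_inv_le_of_posSemidef_three_smul_sub ?_
      convert hRQ.add hX using 1
      abel
    have n3 : ‖(X + S₂) - Q‖ ^ 2 ≤ 2 * (4 * (t + S₂.trace)) ^ 2 * G := by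
      refine (hR.norm_sub_sq_le_logDetGap hQ).trans ?_
      have b1 := hQR.trace_nonneg
      have b2 := hCX.trace_nonneg
      have b3 : 0 ≤ (X + S₂ + Q).trace := (hR.add hQ).posSemidef.trace_nonneg
      simp only [trace_sub, trace_add, trace_smul, smul_eq_mul] at b1 b2 b3 ⊢
      gcongr
      linarith
    rw [norm_sub_rev Z X] at h2
    have hd0 := norm_nonneg ((X + S₂) - Q)
    have hδ0 := norm_nonneg (X - Z)
    generalize ‖(X + S₂) - Q‖ = d at *
    generalize ‖X - Z‖ = δ at *
    have h3 : ‖(Z + S₂)⁻¹‖ * ‖Q⁻¹‖ * ((d + δ) * d) ≤ a * ((d + δ) * d) := by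
      rw [ha]; gcongr
    have h4 := mul_le_mul_of_nonneg_left (h2.trans h3) hl0.le
    have young : lam * a * δ * d ≤ c₀ / 2 * δ ^ 2 + (lam * a) ^ 2 / (2 * c₀) * d ^ 2 := by
      have e : c₀ / 2 * δ ^ 2 + (lam * a) ^ 2 / (2 * c₀) * d ^ 2 - lam * a * δ * d =
          (c₀ * δ - lam * a * d) ^ 2 / (2 * c₀) := by field_simp; ring
      have : 0 ≤ (c₀ * δ - lam * a * d) ^ 2 / (2 * c₀) := by positivity
      linarith
    have h5 : (lam * a + (lam * a) ^ 2 / (2 * c₀)) * d ^ 2 ≤ K₁ * G := by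
      calc _ ≤ (lam * a + (lam * a) ^ 2 / (2 * c₀)) * (2 * (4 * (t + S₂.trace)) ^ 2 * G) := by
            gcongr
        _ = _ := by rw [hK₁]; ring
    have h6 : 0 ≤ (8 * K₂ + 1) * G := by positivity
    simp only [logDetDiff]
    linarith
  · have h1 := logDetDiff_sub_le hlam hS₁ hS₂ hX hZ
    have h2 : (S₁⁻¹.trace + lam * S₂⁻¹.trace) * ‖X - Z‖ + c₀ / 2 * ‖X - Z‖ ^ 2 ≤ K₂ := by
      rw [hK₂]; gcongr
    have h3 : K₂ ≤ 8 * K₂ * G := by nlinarith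
    have h4 : 0 ≤ (K₁ + 1) * G := by positivity
    linarith

end Matrix

/-! ### Continuity, order intervals of symmetric matrices, and the general error bound -/

namespace Matrix
variable {ι : Type*} [Fintype ι]

/-- Positive definite matrices are open among Hermitian matrices. -/
theorem PosDef.eventually_posDef {A : Matrix ι ι ℝ} (hA : A.PosDef) :
    ∀ᶠ B in 𝓝 A, B.IsHermitian → B.PosDef := by
  have hK : IsCompact (Metric.sphere (0 : ι → ℝ) 1) := isCompact_sphere _ _
  have hcont : Continuous fun p : Matrix ι ι ℝ × (ι → ℝ) => star p.2 ⬝ᵥ (p.1 *ᵥ p.2) := by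
    fun_prop
  have hev : ∀ᶠ B in 𝓝 A, ∀ x ∈ Metric.sphere (0 : ι → ℝ) 1, 0 < star x ⬝ᵥ (B *ᵥ x) := by
    refine hK.eventually_forall_of_forall_eventually fun x hx => ?_
    have hx0 : x ≠ 0 := by
      rintro rfl
      simp at hx
    exact continuousAt_const.eventually_lt (hcont.continuousAt (x := (A, x)))
      (hA.dotProduct_mulVec_pos hx0)
  filter_upwards [hev] with B hB hBH
  refine PosDef.of_dotProduct_mulVec_pos hBH fun {x} hx => ?_
  have hn : 0 < ‖x‖ := norm_pos_iff.2 hx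
  have h1 := hB (‖x‖⁻¹ • x) (by simp [norm_smul, hn.ne'])
  simp only [star_trivial, mulVec_smul, smul_dotProduct, dotProduct_smul, smul_eq_mul] at h1 ⊢
  rw [← mul_assoc] at h1
  exact pos_of_mul_pos_right h1 (by positivity)

theorem isClosed_setOf_posSemidef : IsClosed {A : Matrix ι ι ℝ | A.PosSemidef} := by
  have : {A : Matrix ι ι ℝ | A.PosSemidef} =
      {A | Aᴴ = A} ∩ ⋂ x : ι → ℝ, {A | 0 ≤ star x ⬝ᵥ (A *ᵥ x)} := by
    ext A
    simp [posSemidef_iff_dotProduct_mulVec, IsHermitian]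
  rw [this]
  refine (isClosed_eq (by fun_prop) (by fun_prop)).inter (isClosed_iInter fun x => ?_)
  exact isClosed_le (by fun_prop) (by fun_prop)

theorem PosDef.continuousAt_inv [DecidableEq ι] {A : Matrix ι ι ℝ} (hA : A.PosDef) :
    ContinuousAt (fun B : Matrix ι ι ℝ => B⁻¹) A :=
  continuousAt_matrix_inv _ (NormedRing.inverse_continuousAt
    (isUnit_iff_ne_zero.2 hA.det_pos.ne').unit)

theorem PosDef.continuousAt_log_det [DecidableEq ι] {A : Matrix ι ι ℝ} (hA : A.PosDef) :
    ContinuousAt (fun B : Matrix ι ι ℝ => Real.log B.det) A :=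
  (Continuous.matrix_det continuous_id).continuousAt.log hA.det_pos.ne'

theorem tendsto_logDetGap [DecidableEq ι] {κ : Type*} {l : Filter κ} {a b : κ → Matrix ι ι ℝ}
    {A B : Matrix ι ι ℝ} (hA : A.PosDef) (hB : B.PosDef) (ha : Tendsto a l (𝓝 A))
    (hb : Tendsto b l (𝓝 B)) :
    Tendsto (fun k => logDetGap (a k) (b k)) l (𝓝 (logDetGap A B)) := by
  have h1 := hA.continuousAt_log_det.tendsto.comp ha
  have h2 := hB.continuousAt_log_det.tendsto.comp hb
  have h3 := (hB.continuousAt_inv.tendsto.comp hb).mul (ha.sub hb)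
  have h4 := ((Continuous.matrix_trace continuous_id).tendsto _).comp h3
  exact (h2.add h4).sub h1

theorem tendsto_logDetDiff [DecidableEq ι] {κ : Type*} {l : Filter κ} {a : κ → Matrix ι ι ℝ}
    {A S₁ S₂ : Matrix ι ι ℝ} {lam : ℝ} (h₁ : (A + S₁).PosDef) (h₂ : (A + S₂).PosDef)
    (ha : Tendsto a l (𝓝 A)) :
    Tendsto (fun k => logDetDiff S₁ S₂ lam (a k)) l (𝓝 (logDetDiff S₁ S₂ lam A)) := by
  have h1 := h₁.continuousAt_log_det.tendsto.comp (ha.add_const S₁)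
  have h2 := h₂.continuousAt_log_det.tendsto.comp (ha.add_const S₂)
  exact h1.neg.add (h2.const_mul lam)

end Matrix

open Matrix

namespace SymMat
variable {n : ℕ}

@[simp] theorem toMat_add (X Y : SymMat n) : (X + Y).toMat = X.toMat + Y.toMat := rfl
@[simp] theorem toMat_sub (X Y : SymMat n) : (X - Y).toMat = X.toMat - Y.toMat := rfl
@[simp] theorem toMat_neg (X : SymMat n) : (-X).toMat = -X.toMat := rfl
@[simp] theorem toMat_smul (c : ℝ) (X : SymMat n) : (c • X).toMat = c • X.toMat := rfl
@[simp] theorem toMat_zero : (0 : SymMat n).toMat = 0 := rfl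

/-- The element of `SymMat n` with a given Hermitian matrix of entries. -/
noncomputable def ofMat (A : Matrix (Fin n) (Fin n) ℝ) (hA : A.IsHermitian) : SymMat n :=
  ⟨WithLp.toLp 2 fun p => A p.1 p.2, fun i j => by simpa using hA.apply j i⟩

@[simp] theorem toMat_ofMat (A : Matrix (Fin n) (Fin n) ℝ) (hA : A.IsHermitian) :
    (ofMat A hA).toMat = A := rfl

theorem continuous_toMat : Continuous (toMat : SymMat n → _) := by
  refine continuous_matrix fun i j => ?_
  exact (PiLp.continuous_apply 2 _ (i, j)).comp continuous_subtype_val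

open scoped Matrix.Norms.Frobenius in
theorem norm_toMat (X : SymMat n) : ‖X.toMat‖ = ‖X‖ := by
  rw [← sq_eq_sq₀ (norm_nonneg _) (norm_nonneg _), frobenius_norm_sq, X.toMat_isHermitian.eq,
    ← inner_eq_trace, real_inner_self_eq_norm_sq]

theorem norm_le_trace {X : SymMat n} (hX : X.toMat.PosSemidef) : ‖X‖ ≤ X.toMat.trace := by
  rw [← norm_toMat]
  exact hX.frobenius_norm_le_trace

/-- The order interval `0 ⪯ X ⪯ C`. -/
def box (C : Matrix (Fin n) (Fin n) ℝ) : Set (SymMat n) :=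
  {X | X.toMat.PosSemidef ∧ (C - X.toMat).PosSemidef}

variable {C : Matrix (Fin n) (Fin n) ℝ}

theorem zero_mem_box (hC : C.PosSemidef) : (0 : SymMat n) ∈ box C :=
  ⟨by simpa using PosSemidef.zero, by simpa using hC⟩

theorem isClosed_box : IsClosed (box C) :=
  (isClosed_setOf_posSemidef.preimage continuous_toMat).inter
    (isClosed_setOf_posSemidef.preimage (continuous_const.sub continuous_toMat))

theorem convex_box : Convex ℝ (box C) := by
  intro X hX Y hY a b ha hb hab
  refine ⟨(hX.1.smul ha).add (hY.1.smul hb), ?_⟩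
  have : C - (a • X + b • Y).toMat = a • (C - X.toMat) + b • (C - Y.toMat) := by
    have hC : C = a • C + b • C := by rw [← add_smul, hab, one_smul]
    rw [toMat_add, toMat_smul, toMat_smul, smul_sub, smul_sub]
    nth_rw 1 [hC]
    abel
  rw [this]
  exact (hX.2.smul ha).add (hY.2.smul hb)

theorem isBounded_box : Bornology.IsBounded (box C) := by
  refine (Metric.isBounded_closedBall (x := (0 : SymMat n)) (r := C.trace)).subset fun X hX => ?_
  have := hX.2.trace_nonneg
  rw [trace_sub] at this
  rw [mem_closedBall_zero_iff]
  linarith [norm_le_trace hX.1]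

theorem isCompact_box : IsCompact (box C) :=
  Metric.isCompact_of_isClosed_isBounded isClosed_box isBounded_box

theorem box_mono {C' : Matrix (Fin n) (Fin n) ℝ} (h : (C' - C).PosSemidef) : box C ⊆ box C' := by
  intro X hX
  refine ⟨hX.1, ?_⟩
  convert h.add hX.2 using 1
  abel

theorem exists_isProj_box (hC : C.PosSemidef) (U : SymMat n) :
    ∃ p ∈ box C, U - p ∈ normalConeAt (box C) p := by
  obtain ⟨p, hp, h⟩ := exists_norm_eq_iInf_of_complete_convex ⟨0, zero_mem_box hC⟩
    isClosed_box.isComplete convex_box U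
  exact ⟨p, hp, (norm_eq_iInf_iff_real_inner_le_zero convex_box hp).1 h⟩

/-- A normal vector of `[0, C]` is a limit of normal vectors of order intervals `[0, D k]` with
invertible `D k`: with `D k = C + ε k • 1`, project `X + Y` onto `[0, D k]`. The projections
converge to the projection `X` of `X + Y` onto `[0, C]`. -/
theorem exists_normal_approximation (hC : C.PosSemidef) {X Y : SymMat n} (hX : X ∈ box C)
    (hY : Y ∈ normalConeAt (box C) X) :
    ∃ (D : ℕ → Matrix (Fin n) (Fin n) ℝ) (x : ℕ → SymMat n),
      (∀ k, (D k).PosDef ∧ (D k).trace ≤ C.trace + n ∧ box C ⊆ box (D k) ∧ x k ∈ box (D k) ∧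
        X + Y - x k ∈ normalConeAt (box (D k)) (x k)) ∧ Tendsto x atTop (𝓝 X) := by
  set ε : ℕ → ℝ := fun k => 1 / ((k : ℝ) + 1) with hε
  have hε0 : ∀ k, 0 < ε k := fun k => by simp only [hε]; positivity
  have hε1 : ∀ k, ε k ≤ 1 := fun k => by
    simp only [hε]
    rw [div_le_one (by positivity)]
    linarith [(Nat.cast_nonneg k : (0 : ℝ) ≤ k)]
  have hεlim : Tendsto ε atTop (𝓝 0) := tendsto_one_div_add_atTop_nhds_zero_nat
  set D : ℕ → Matrix (Fin n) (Fin n) ℝ := fun k => C + ε k • (1 : Matrix (Fin n) (Fin n) ℝ) with hD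
  have hDC : ∀ k, (D k - C).PosSemidef := fun k => by
    simpa [hD] using PosSemidef.one.smul (hε0 k).le
  have hDpd : ∀ k, (D k).PosDef := fun k => (PosDef.one.smul (hε0 k)).posSemidef_add hC
  have hD1 : ∀ k, ((C + 1) - D k).PosSemidef := fun k => by
    have : (C + 1) - D k = (1 - ε k) • (1 : Matrix (Fin n) (Fin n) ℝ) := by
      simp only [hD, sub_smul, one_smul]; abel
    rw [this]
    exact PosSemidef.one.smul (by linarith [hε1 k])
  choose p hp hpn using fun k => exists_isProj_box (hDpd k).posSemidef (X + Y)
  obtain ⟨q, -, φ, hφ, hq⟩ := (isCompact_box (C := C + 1)).tendsto_subseq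
    fun k => box_mono (hD1 k) (hp k)
  have hqm : Tendsto (fun k => (p (φ k)).toMat) atTop (𝓝 q.toMat) :=
    (continuous_toMat.tendsto q).comp hq
  have hDlim : Tendsto (fun k => D (φ k)) atTop (𝓝 C) := by
    have h1 : Tendsto (fun k => ε (φ k)) atTop (𝓝 0) := hεlim.comp hφ.tendsto_atTop
    have h2 := (h1.smul_const (1 : Matrix (Fin n) (Fin n) ℝ)).const_add C
    simpa using h2
  have hqC : q ∈ box C :=
    ⟨isClosed_setOf_posSemidef.mem_of_tendsto hqm (Eventually.of_forall fun k => (hp (φ k)).1),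
      isClosed_setOf_posSemidef.mem_of_tendsto (hDlim.sub hqm)
        (Eventually.of_forall fun k => (hp (φ k)).2)⟩
  have hqX : q = X := by
    have h1 : inner ℝ (X + Y - q) (X - q) ≤ 0 := by
      have : Tendsto (fun k => inner ℝ (X + Y - p (φ k)) (X - p (φ k))) atTop
          (𝓝 (inner ℝ (X + Y - q) (X - q))) := (hq.const_sub _).inner (hq.const_sub _)
      exact le_of_tendsto this (Eventually.of_forall fun k =>
        hpn (φ k) X (box_mono (hDC _) hX))
    have h2 := hY q hqC
    have h3 : inner ℝ (X - q) (X - q) ≤ 0 := by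
      have e : inner ℝ (X - q) (X - q) = inner ℝ (X + Y - q) (X - q) + inner ℝ Y (q - X) := by
        rw [show X + Y - q = (X - q) + Y by abel, inner_add_left, ← neg_sub X q, inner_neg_right]
        ring
      linarith
    have h4 := real_inner_self_nonpos.1 h3
    exact (sub_eq_zero.1 h4).symm
  refine ⟨fun k => D (φ k), fun k => p (φ k), fun k => ⟨hDpd _, ?_, box_mono (hDC _), hp _, hpn _⟩,
    hqX ▸ hq⟩
  have : (D (φ k)).trace = C.trace + ε (φ k) * n := by simp [hD, trace_add, trace_smul]
  rw [this]
  have := mul_le_mul_of_nonneg_right (hε1 (φ k)) (Nat.cast_nonneg n : (0 : ℝ) ≤ n)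
  linarith

/-- The error bound behind the theorem: `Q` is the matrix for which `Y` makes `X` stationary, and
`logDetGap (X + S₂) Q` is, up to the factor `lam`, the Bregman distance of the DC-PL inequality. The
quadratic term on the left is more than that inequality asks for; it gives uniqueness of the
minimizer and convergence of the iterates. -/
def ErrorBound (S₁ S₂ C : Matrix (Fin n) (Fin n) ℝ) (lam c K : ℝ) : Prop :=
  ∀ X ∈ box C, ∀ Z ∈ box C, ∀ Y ∈ normalConeAt (box C) X,
    ∀ Q : Matrix (Fin n) (Fin n) ℝ, Q.PosDef → lam • Q⁻¹ = (X.toMat + S₁)⁻¹ - Y.toMat →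
    logDetDiff S₁ S₂ lam X.toMat - logDetDiff S₁ S₂ lam Z.toMat + c * ‖X - Z‖ ^ 2 ≤
      K * logDetGap (X.toMat + S₂) Q

theorem exists_errorBound {S₁ S₂ : Matrix (Fin n) (Fin n) ℝ} {lam : ℝ}
    (hlam : 1 < lam) (hS₁ : S₁.PosDef) (hS₂ : S₂.PosDef) (hC : C.PosSemidef) :
    ∃ c K : ℝ, 0 < c ∧ 0 < K ∧ ErrorBound S₁ S₂ C lam c K := by
  have hl0 : 0 < lam := by linarith
  obtain ⟨c, K, hc, hK, hbound⟩ := exists_errorBound_of_posDef hlam hS₁ hS₂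
    (t := C.trace + n) (add_nonneg hC.trace_nonneg (Nat.cast_nonneg n))
  refine ⟨c, K, hc, hK, fun X hX Z hZ Y hY Q hQ hstat => ?_⟩
  obtain ⟨D, x, hx, hlim⟩ := exists_normal_approximation hC hX hY
  have hxm : Tendsto (fun k => (x k).toMat) atTop (𝓝 X.toMat) :=
    (continuous_toMat.tendsto X).comp hlim
  have hX1 := hS₁.posSemidef_add hX.1
  have hX2 := hS₂.posSemidef_add hX.1
  -- the dual variable `lam • Q⁻¹` is perturbed along with the primal point
  set W : ℕ → Matrix (Fin n) (Fin n) ℝ := fun k =>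
    ((x k).toMat + S₁)⁻¹ - (X.toMat + Y.toMat - (x k).toMat) with hW
  have hWlim : Tendsto W atTop (𝓝 (lam • Q⁻¹)) := by
    have h := (hX1.continuousAt_inv.tendsto.comp (hxm.add_const S₁)).sub
      (hxm.const_sub (X.toMat + Y.toMat))
    rw [hstat]
    simpa [hW] using h
  have hWpd : ∀ᶠ k in atTop, (W k).PosDef := by
    filter_upwards [hWlim.eventually (hQ.inv.smul hl0).eventually_posDef] with k hk
    refine hk (IsHermitian.sub ?_ ?_)
    · exact (hS₁.posSemidef_add (hx k).2.2.2.1.1).inv.isHermitian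
    · exact (X + Y - x k).toMat_isHermitian
  have hQlim : Tendsto (fun k => lam • (W k)⁻¹) atTop (𝓝 Q) := by
    have h := ((hQ.inv.smul hl0).continuousAt_inv.tendsto.comp hWlim).const_smul lam
    rwa [smul_inv_smul_inv hQ hl0.ne'] at h
  refine le_of_tendsto_of_tendsto
    (((tendsto_logDetDiff hX1 hX2 hxm).sub_const (logDetDiff S₁ S₂ lam Z.toMat)).add
      (((hlim.sub_const Z).norm.pow 2).const_mul c))
    ((tendsto_logDetGap hX2 hQ (hxm.add_const S₂) hQlim).const_mul K) ?_
  filter_upwards [hWpd] with k hk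
  obtain ⟨hD, htr, hsub, hxk, hn⟩ := hx k
  have h := hbound (D k) (x k).toMat Z.toMat (X + Y - x k).toMat (lam • (W k)⁻¹) hD htr hxk.1 hxk.2
    (hsub hZ).1 (hsub hZ).2 (toMat_isHermitian _) (fun V hV hDV => by
      have := hn (ofMat V hV.isHermitian) ⟨hV, hDV⟩
      rwa [inner_eq_trace] at this) (hk.inv.smul hl0) (by
      rw [smul_inv_smul_inv hk hl0.ne']
      rfl)
  rwa [← toMat_sub, norm_toMat] at h

end SymMat

/-! ### Gradients and the log-determinant barrier -/

section Gradient
variable {E : Type*} [NormedAddCommGroup E] [InnerProductSpace ℝ E] [CompleteSpace E]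

theorem HasGradientAt.sub {φ ψ : E → ℝ} {G H x : E} (hφ : HasGradientAt φ G x)
    (hψ : HasGradientAt ψ H x) : HasGradientAt (fun z => φ z - ψ z) (G - H) x := by
  rw [hasGradientAt_iff_hasFDerivAt] at hφ hψ ⊢
  rw [map_sub]
  exact HasFDerivAt.sub hφ hψ

theorem hasGradientAt_const_add_inner (a : ℝ) (G y x : E) :
    HasGradientAt (fun z => a + inner ℝ G (z - y)) G x := by
  rw [hasGradientAt_iff_hasFDerivAt]
  refine HasFDerivAt.const_add _ ?_
  exact (InnerProductSpace.toDual ℝ E G).hasFDerivAt.comp (f := fun z => z - y) x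
    ((hasFDerivAt_id x).sub_const y)

/-- A subgradient at a point of differentiability is the gradient. -/
theorem HasGradientAt.of_eventually_le {φ : E → ℝ} {G x : E} (hφ : DifferentiableAt ℝ φ x)
    (h : ∀ᶠ z in 𝓝 x, φ x + inner ℝ G (z - x) ≤ φ z) : HasGradientAt φ G x := by
  have hmin : IsLocalMin (fun z => φ z - (φ x + inner ℝ G (z - x))) x := by
    filter_upwards [h] with z hz
    simp only [sub_self, inner_zero_right, add_zero]
    linarith
  have h0 := hmin.hasFDerivAt_eq_zero
    (hφ.hasFDerivAt.sub (hasGradientAt_const_add_inner (φ x) G x x).hasFDerivAt)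
  rw [hasGradientAt_iff_hasFDerivAt, ← sub_eq_zero.1 h0]
  exact hφ.hasFDerivAt

theorem IsMinOn.neg_gradient_mem_normalConeAt {φ : E → ℝ} {G x : E} {K : Set E}
    (hmin : IsMinOn φ K x) (hK : Convex ℝ K) (hx : x ∈ K) (hG : HasGradientAt φ G x) :
    -G ∈ normalConeAt K x := by
  intro z hz
  have h := IsLocalMinOn.hasFDerivWithinAt_nonneg hmin.localize
    (hasGradientAt_iff_hasFDerivAt.1 hG).hasFDerivWithinAt
    (sub_mem_posTangentConeAt_of_segment_subset (hK.segment_subset hx hz))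
  rw [InnerProductSpace.toDual_apply_apply] at h
  rw [inner_neg_left]
  linarith

end Gradient

namespace SymMat
variable {n : ℕ} {S : Matrix (Fin n) (Fin n) ℝ} {c : ℝ}

/-- The domain of the log-determinant barrier with offset `S`. -/
def logDetDom (S : Matrix (Fin n) (Fin n) ℝ) : Set (SymMat n) := {X | (X.toMat + S).PosDef}

/-- The scaled log-determinant barrier `X ↦ -c log det (X + S)`. -/
noncomputable def logBarrier (S : Matrix (Fin n) (Fin n) ℝ) (c : ℝ) (X : SymMat n) : ℝ :=
  -c * Real.log (X.toMat + S).det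

/-- The gradient `-c (X + S)⁻¹` of `logBarrier S c` at a point `X` of its domain. -/
noncomputable def barrierGrad (S : Matrix (Fin n) (Fin n) ℝ) (hS : S.IsHermitian) (c : ℝ)
    (X : SymMat n) : SymMat n :=
  -c • ofMat (X.toMat + S)⁻¹ (X.toMat_isHermitian.add hS).inv

theorem toMat_barrierGrad (hS : S.IsHermitian) (X : SymMat n) :
    (barrierGrad S hS c X).toMat = -c • (X.toMat + S)⁻¹ := rfl

theorem contDiff_det_toMat_add (S : Matrix (Fin n) (Fin n) ℝ) :
    ContDiff ℝ 1 fun X : SymMat n => (X.toMat + S).det := by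
  have he : ∀ i j, ContDiff ℝ 1 fun X : SymMat n => (X.toMat + S) i j := by
    intro i j
    have h1 : ContDiff ℝ 1 fun X : SymMat n =>
        (X : EuclideanSpace ℝ (Fin n × Fin n)) (i, j) :=
      ((EuclideanSpace.proj (i, j) : EuclideanSpace ℝ (Fin n × Fin n) →L[ℝ] ℝ).comp
        (symSubmodule n).subtypeL).contDiff
    exact h1.add contDiff_const
  simp only [det_apply]
  refine ContDiff.sum fun σ _ => ContDiff.const_smul _ ?_
  exact contDiff_prod fun i _ => he _ _

theorem contDiffOn_logBarrier : ContDiffOn ℝ 1 (logBarrier S c) (logDetDom S) :=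
  contDiffOn_const.mul
    ((contDiff_det_toMat_add S).contDiffOn.log fun _ hX => (PosDef.det_pos hX).ne')

theorem isOpen_logDetDom (hS : S.IsHermitian) : IsOpen (logDetDom S) := by
  rw [isOpen_iff_eventually]
  intro X hX
  have h := ((continuous_toMat (n := n)).add_const S).tendsto X |>.eventually
    (PosDef.eventually_posDef hX)
  filter_upwards [h] with Z hZ
  exact hZ (Z.toMat_isHermitian.add hS)

theorem logBarrier_tangent (hS : S.IsHermitian) (hc : 0 ≤ c) {X Z : SymMat n}
    (hX : X ∈ logDetDom S) (hZ : Z ∈ logDetDom S) :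
    logBarrier S c X + inner ℝ (barrierGrad S hS c X) (Z - X) ≤ logBarrier S c Z := by
  have h := PosDef.logDetGap_nonneg hZ hX
  have e : Z.toMat + S - (X.toMat + S) = Z.toMat - X.toMat := by abel
  rw [logDetGap, e] at h
  rw [inner_eq_trace, toMat_barrierGrad, Matrix.smul_mul, trace_smul, toMat_sub]
  simp only [logBarrier, smul_eq_mul]
  nlinarith

theorem hasGradientAt_logBarrier (hS : S.IsHermitian) (hc : 0 ≤ c) {X : SymMat n}
    (hX : X ∈ logDetDom S) : HasGradientAt (logBarrier S c) (barrierGrad S hS c X) X := by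
  have hnhds := (isOpen_logDetDom hS).mem_nhds hX
  refine HasGradientAt.of_eventually_le
    ((contDiffOn_logBarrier.differentiableOn one_ne_zero).differentiableAt hnhds) ?_
  filter_upwards [hnhds] with Z hZ using logBarrier_tangent hS hc hX hZ

theorem convex_logDetDom : Convex ℝ (logDetDom S) := by
  intro X hX Y hY a b ha hb hab
  have : (a • X + b • Y).toMat + S = a • (X.toMat + S) + b • (Y.toMat + S) := by
    have hS : S = a • S + b • S := by rw [← add_smul, hab, one_smul]
    rw [toMat_add, toMat_smul, toMat_smul, smul_add, smul_add]
    nth_rw 1 [hS]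
    abel
  change ((a • X + b • Y).toMat + S).PosDef
  rw [this]
  rcases ha.eq_or_lt with rfl | ha
  · rw [zero_add] at hab
    subst hab
    simpa using! hY
  · exact (PosDef.smul hX ha).add_posSemidef ((PosDef.posSemidef hY).smul hb)

theorem convexOn_logBarrier (hS : S.IsHermitian) (hc : 0 ≤ c) :
    ConvexOn ℝ (logDetDom S) (logBarrier S c) := by
  refine ⟨convex_logDetDom, fun X hX Y hY a b ha hb hab => ?_⟩
  have hZ := convex_logDetDom hX hY ha hb hab
  set Z := a • X + b • Y with hZdef
  have h1 := mul_le_mul_of_nonneg_left (logBarrier_tangent hS hc hZ hX) ha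
  have h2 := mul_le_mul_of_nonneg_left (logBarrier_tangent hS hc hZ hY) hb
  have e : a * inner ℝ (barrierGrad S hS c Z) (X - Z) +
      b * inner ℝ (barrierGrad S hS c Z) (Y - Z) = 0 := by
    rw [← real_inner_smul_right, ← real_inner_smul_right, ← inner_add_right]
    have : a • (X - Z) + b • (Y - Z) = 0 := by
      have h3 : a • Z + b • Z = Z := by rw [← add_smul, hab, one_smul]
      rw [smul_sub, smul_sub]
      calc _ = (a • X + b • Y) - (a • Z + b • Z) := by abel
        _ = 0 := by rw [h3, hZdef, sub_self]
    rw [this, inner_zero_right]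
  have e2 : a * logBarrier S c Z + b * logBarrier S c Z = logBarrier S c Z := by
    rw [← add_mul, hab, one_mul]
  simp only [smul_eq_mul]
  linarith

theorem isClosedConvexC1_logBarrier (hS : S.IsHermitian) (hc : 0 < c) :
    IsClosedConvexC1 (logDetDom S) (logBarrier S c) where
  isOpen_dom := isOpen_logDetDom hS
  convexOn := convexOn_logBarrier hS hc.le
  isClosed_epigraph := by
    -- `-c log det ≤ t` reads `exp (-t / c) ≤ det`, which keeps limits of the domain invertible
    have : {p : SymMat n × ℝ | p.1 ∈ logDetDom S ∧ logBarrier S c p.1 ≤ p.2} =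
        {p | (p.1.toMat + S).PosSemidef} ∩ {p | Real.exp (-p.2 / c) ≤ (p.1.toMat + S).det} := by
      ext ⟨X, t⟩
      simp only [Set.mem_ofPred_eq, Set.mem_inter_iff, logDetDom, logBarrier]
      have key : ∀ d : ℝ, 0 < d → (-c * Real.log d ≤ t ↔ Real.exp (-t / c) ≤ d) := by
        intro d hd
        rw [← Real.le_log_iff_exp_le hd, div_le_iff₀ hc]
        constructor <;> intro h <;> linarith
      constructor
      · rintro ⟨h1, h2⟩
        exact ⟨h1.posSemidef, (key _ h1.det_pos).1 h2⟩
      · rintro ⟨h1, h2⟩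
        have hd := (Real.exp_pos _).trans_le h2
        exact ⟨h1.posDef_iff_det_ne_zero.2 hd.ne', (key _ hd).2 h2⟩
    rw [this]
    have hcont : Continuous fun p : SymMat n × ℝ => p.1.toMat + S :=
      (continuous_toMat.comp continuous_fst).add_const S
    exact (isClosed_setOf_posSemidef.preimage hcont).inter
      (isClosed_le (by fun_prop) hcont.matrix_det)
  contDiffOn := contDiffOn_logBarrier

/-! ### The conjugate of the log-determinant barrier -/

/-- On the negative definite cone the conjugate is attained at `X` with `X + S = c (-U)⁻¹`, and the
defect of any other `X` is a Bregman distance. -/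
theorem inner_sub_logBarrier (hS : S.IsHermitian) (hc : 0 < c) {U : SymMat n}
    (hU : (-U.toMat).PosDef) (X : SymMat n) :
    inner ℝ U X - logBarrier S c X = -(c * n) - inner ℝ U (ofMat S hS) +
      c * (n * Real.log c - Real.log (-U.toMat).det) -
      c * logDetGap (X.toMat + S) (c • (-U.toMat)⁻¹) := by
  have huU : IsUnit (-U.toMat).det := isUnit_iff_ne_zero.2 hU.det_pos.ne'
  set Q : Matrix (Fin n) (Fin n) ℝ := c • (-U.toMat)⁻¹ with hQ
  have hUQ : U.toMat * Q = -c • (1 : Matrix (Fin n) (Fin n) ℝ) := by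
    have h := mul_nonsing_inv _ huU
    rw [Matrix.neg_mul] at h
    rw [hQ, Matrix.mul_smul, neg_smul, ← h, smul_neg, neg_neg]
  have hlogQ : Real.log Q.det = n * Real.log c - Real.log (-U.toMat).det := by
    rw [hQ, det_smul, det_nonsing_inv, Ring.inverse_eq_inv', Real.log_mul (by positivity)
      (inv_ne_zero huU.ne_zero), Real.log_pow, Real.log_inv, Fintype.card_fin]
    ring
  have hQinv : Q⁻¹ = -c⁻¹ • U.toMat := by
    refine inv_eq_left_inv ?_
    rw [Matrix.smul_mul, hUQ, smul_smul]
    field_simp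
    simp
  rw [logDetGap, hQinv, hlogQ, inner_eq_trace, inner_eq_trace, toMat_ofMat, Matrix.smul_mul,
    Matrix.mul_sub, Matrix.mul_add, hUQ]
  simp only [trace_smul, trace_add, trace_sub, trace_one, smul_eq_mul, Fintype.card_fin,
    logBarrier]
  field_simp
  ring

theorem convexConj_logBarrier (hS : S.IsHermitian) (hc : 0 < c) {U : SymMat n}
    (hU : (-U.toMat).PosDef) :
    convexConj (logDetDom S) (logBarrier S c) U =
      ((-(c * n) - inner ℝ U (ofMat S hS) +
        c * (n * Real.log c - Real.log (-U.toMat).det) : ℝ) : EReal) := by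
  set Q : Matrix (Fin n) (Fin n) ℝ := c • (-U.toMat)⁻¹ with hQ
  have hQpd : Q.PosDef := hU.inv.smul hc
  refine le_antisymm (iSup₂_le fun X hX => ?_) ?_
  · rw [EReal.coe_le_coe_iff, inner_sub_logBarrier hS hc hU]
    have := mul_nonneg hc.le (PosDef.logDetGap_nonneg hX hQpd)
    linarith
  · have hX : ofMat (Q - S) (hQpd.isHermitian.sub hS) ∈ logDetDom S := by
      change (Q - S + S).PosDef
      simpa using hQpd
    refine le_trans ?_ (le_iSup₂_of_le _ hX le_rfl)
    rw [inner_sub_logBarrier hS hc hU, toMat_ofMat, sub_add_cancel, logDetGap_self, mul_zero,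
      sub_zero]

theorem convexConj_logBarrier_eq_add_gap (hS : S.IsHermitian) (hc : 0 < c) {U : SymMat n}
    (hU : (-U.toMat).PosDef) (X : SymMat n) :
    convexConj (logDetDom S) (logBarrier S c) U =
      ((inner ℝ U X - logBarrier S c X +
        c * logDetGap (X.toMat + S) (c • (-U.toMat)⁻¹) : ℝ) : EReal) := by
  rw [convexConj_logBarrier hS hc hU, inner_sub_logBarrier hS hc hU, sub_add_cancel]

/-- Off the negative definite cone the conjugate is infinite, so that the DC-PL inequality is only
at stake for negative definite `U`. -/
theorem convexConj_logBarrier_eq_top (hS : S.PosDef) (hc : 0 < c) {U : SymMat n}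
    (hU : ¬ (-U.toMat).PosDef) : convexConj (logDetDom S) (logBarrier S c) U = ⊤ := by
  obtain ⟨x, hx0, hx⟩ : ∃ x : Fin n → ℝ, x ≠ 0 ∧ 0 ≤ x ⬝ᵥ (U.toMat *ᵥ x) := by
    by_contra! hcon
    refine hU (PosDef.of_dotProduct_mulVec_pos U.toMat_isHermitian.neg fun {x} hx => ?_)
    have := hcon x hx
    rw [star_trivial, neg_mulVec, dotProduct_neg]
    linarith
  have hs : 0 < x ⬝ᵥ (S⁻¹ *ᵥ x) := by simpa using hS.inv.dotProduct_mulVec_pos hx0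
  have hE : (vecMulVec x x).PosSemidef := by simpa using posSemidef_vecMulVec_self_star x
  -- the objective grows like `log t` along the ray spanned by `x xᵀ`
  have hdet : ∀ t : ℝ, (t • vecMulVec x x + S).det = S.det * (1 + t * (x ⬝ᵥ (S⁻¹ *ᵥ x))) := by
    intro t
    have h := det_add_replicateCol_mul_replicateRow (ι := Unit)
      (isUnit_iff_ne_zero.2 hS.det_pos.ne') (t • x) x
    rw [← vecMulVec_eq, smul_vecMulVec] at h
    rw [add_comm, h, det_unique (n := Unit), Matrix.add_apply, one_apply_eq, Matrix.mul_assoc,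
      ← replicateCol_mulVec, replicateRow_mul_replicateCol_apply, mulVec_smul, dotProduct_smul,
      smul_eq_mul]
  have hlim : Tendsto (fun t : ℝ => c * (Real.log S.det +
      Real.log (1 + t * (x ⬝ᵥ (S⁻¹ *ᵥ x))))) atTop atTop := by
    refine Tendsto.const_mul_atTop hc (tendsto_atTop_add_const_left _ _ ?_)
    exact Real.tendsto_log_atTop.comp
      (tendsto_atTop_add_const_left _ _ (tendsto_id.atTop_mul_const hs))
  rw [EReal.eq_top_iff_forall_lt]
  intro y
  obtain ⟨t, ht0, hty⟩ := ((eventually_ge_atTop (0 : ℝ)).and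
    (hlim.eventually_gt_atTop y)).exists
  have hXt := hE.smul ht0
  have hX : ofMat (t • vecMulVec x x) hXt.isHermitian ∈ logDetDom S := hS.posSemidef_add hXt
  refine lt_of_lt_of_le ?_ (le_iSup₂_of_le _ hX le_rfl)
  rw [EReal.coe_lt_coe_iff, logBarrier, toMat_ofMat, hdet,
    Real.log_mul hS.det_pos.ne' (by positivity), inner_eq_trace, toMat_ofMat, Matrix.mul_smul,
    trace_smul, mul_vecMulVec, trace_vecMulVec, dotProduct_comm, smul_eq_mul]
  have := mul_nonneg ht0 hx
  linarith

theorem neg_toMat_barrierGrad_posDef (hS : S.IsHermitian) (hc : 0 < c) {X : SymMat n}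
    (hX : X ∈ logDetDom S) : (-(barrierGrad S hS c X).toMat).PosDef := by
  rw [toMat_barrierGrad, neg_smul, neg_neg]
  exact (PosDef.inv hX).smul hc

theorem eventually_neg_toMat_posDef {V : SymMat n} (hV : (-V.toMat).PosDef) :
    ∀ᶠ U in 𝓝 V, (-(U : SymMat n).toMat).PosDef := by
  filter_upwards [((continuous_toMat (n := n)).neg.tendsto V).eventually hV.eventually_posDef]
    with U hU using hU U.toMat_isHermitian.neg

theorem mem_interior_effDom_convexConj (hS : S.IsHermitian) (hc : 0 < c) {V : SymMat n}
    (hV : (-V.toMat).PosDef) :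
    V ∈ interior (effDom (convexConj (logDetDom S) (logBarrier S c))) := by
  rw [mem_interior_iff_mem_nhds]
  filter_upwards [eventually_neg_toMat_posDef hV] with U hU
  change convexConj (logDetDom S) (logBarrier S c) U < ⊤
  rw [convexConj_logBarrier hS hc hU]
  exact EReal.coe_lt_top _

theorem differentiableAt_convexConj (hS : S.IsHermitian) (hc : 0 < c) {V : SymMat n}
    (hV : (-V.toMat).PosDef) :
    DifferentiableAt ℝ (fun U => (convexConj (logDetDom S) (logBarrier S c) U).toReal) V := by
  have hev : (fun U => (convexConj (logDetDom S) (logBarrier S c) U).toReal) =ᶠ[𝓝 V]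
      fun U => -(c * n) - inner ℝ U (ofMat S hS) +
        c * (n * Real.log c - Real.log (-U.toMat).det) := by
    filter_upwards [eventually_neg_toMat_posDef hV] with U hU
    rw [convexConj_logBarrier hS hc hU, EReal.toReal_coe]
  refine DifferentiableAt.congr_of_eventuallyEq ?_ hev
  have hdet : DifferentiableAt ℝ (fun U : SymMat n => (-U.toMat).det) V := by
    have h := ((contDiff_det_toMat_add (0 : Matrix (Fin n) (Fin n) ℝ)).differentiable
      one_ne_zero).comp (differentiable_id.neg : Differentiable ℝ fun U : SymMat n => -U)
    simpa [Function.comp_def] using h.differentiableAt (x := V)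
  have hlog := hdet.log hV.det_pos.ne'
  have hinner : DifferentiableAt ℝ (fun U : SymMat n => inner ℝ U (ofMat S hS)) V :=
    differentiableAt_id.inner ℝ (differentiableAt_const _)
  fun_prop

theorem convexConj_barrierGrad (hS : S.IsHermitian) (hc : 0 < c) {X : SymMat n}
    (hX : X ∈ logDetDom S) :
    convexConj (logDetDom S) (logBarrier S c) (barrierGrad S hS c X) =
      ((inner ℝ (barrierGrad S hS c X) X - logBarrier S c X : ℝ) : EReal) := by
  refine le_antisymm (iSup₂_le fun Z hZ => ?_) (le_iSup₂_of_le X hX le_rfl)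
  rw [EReal.coe_le_coe_iff]
  have := logBarrier_tangent hS hc.le hX hZ
  rw [inner_sub_right] at this
  linarith

theorem hasGradientAt_convexConj (hS : S.IsHermitian) (hc : 0 < c) {X : SymMat n}
    (hX : X ∈ logDetDom S) :
    HasGradientAt (fun U => (convexConj (logDetDom S) (logBarrier S c) U).toReal) X
      (barrierGrad S hS c X) := by
  have hV := neg_toMat_barrierGrad_posDef hS hc hX
  refine HasGradientAt.of_eventually_le (differentiableAt_convexConj hS hc hV) ?_
  filter_upwards [eventually_neg_toMat_posDef hV] with U hU
  rw [convexConj_barrierGrad hS hc hX, convexConj_logBarrier_eq_add_gap hS hc hU X,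
    EReal.toReal_coe, EReal.toReal_coe, inner_sub_right, real_inner_comm U X,
    real_inner_comm (barrierGrad S hS c X) X]
  have := mul_nonneg hc.le (PosDef.logDetGap_nonneg hX (hU.inv.smul hc))
  linarith

theorem bregman_convexConj_eq_top (hS : S.PosDef) (hc : 0 < c) {X U : SymMat n}
    (hX : X ∈ logDetDom S) (hU : ¬ (-U.toMat).PosDef) :
    bregman (convexConj (logDetDom S) (logBarrier S c)) U
      (barrierGrad S hS.isHermitian c X) = ⊤ := by
  rw [bregman, convexConj_logBarrier_eq_top hS hc hU, convexConj_logBarrier hS.isHermitian hc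
    (neg_toMat_barrierGrad_posDef hS.isHermitian hc hX), EReal.top_sub_coe, EReal.top_sub_coe]

theorem bregman_convexConj (hS : S.IsHermitian) (hc : 0 < c) {X U : SymMat n}
    (hX : X ∈ logDetDom S) (hU : (-U.toMat).PosDef) :
    bregman (convexConj (logDetDom S) (logBarrier S c)) U (barrierGrad S hS c X) =
      ((c * logDetGap (X.toMat + S) (c • (-U.toMat)⁻¹) : ℝ) : EReal) := by
  rw [bregman, convexConj_logBarrier_eq_add_gap hS hc hU X, convexConj_barrierGrad hS hc hX,
    (hasGradientAt_convexConj hS hc hX).gradient, ← EReal.coe_sub, ← EReal.coe_sub,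
    inner_sub_right, real_inner_comm U X, real_inner_comm (barrierGrad S hS c X) X]
  congr 1
  ring

end SymMat

/-! ### The broadcast problem and the difference-of-convex algorithm -/

namespace SymMat
variable {n : ℕ} {S S₁ S₂ C : Matrix (Fin n) (Fin n) ℝ} {c lam : ℝ}

theorem box_subset_logDetDom (hS : S.PosDef) : box C ⊆ logDetDom S :=
  fun _ hX => hS.posSemidef_add hX.1

theorem norm_barrierGrad_le (hS : S.PosDef) (hc : 0 ≤ c) {X : SymMat n} (hX : X ∈ box C) :
    ‖barrierGrad S hS.isHermitian c X‖ ≤ c * S⁻¹.trace := by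
  rw [barrierGrad, norm_smul, norm_neg, Real.norm_of_nonneg hc, ← norm_toMat, toMat_ofMat]
  gcongr
  exact hS.norm_inv_le_trace_inv (by simpa using hX.1)

theorem logBarrier_bregman (hS : S.IsHermitian) (X X' : SymMat n) :
    logBarrier S c X' - logBarrier S c X - inner ℝ (barrierGrad S hS c X) (X' - X) =
      c * logDetGap (X'.toMat + S) (X.toMat + S) := by
  have e : X'.toMat + S - (X.toMat + S) = X'.toMat - X.toMat := by abel
  rw [logDetGap, e, inner_eq_trace, toMat_barrierGrad, Matrix.smul_mul, trace_smul, toMat_sub]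
  simp only [logBarrier, smul_eq_mul]
  ring

theorem broadcastProblem_g : (broadcastProblem S₁ S₂ C lam).g = logBarrier S₁ 1 := by
  funext X
  simp [broadcastProblem, logBarrier]

theorem broadcastProblem_h : (broadcastProblem S₁ S₂ C lam).h = logBarrier S₂ lam := rfl

theorem broadcastProblem_f (X : SymMat n) :
    (broadcastProblem S₁ S₂ C lam).f X = logDetDiff S₁ S₂ lam X.toMat := by
  simp [broadcastProblem, DCProblem.f, logDetDiff]

theorem broadcastProblem_f_eq_sub (X : SymMat n) :
    (broadcastProblem S₁ S₂ C lam).f X = logBarrier S₁ 1 X - logBarrier S₂ lam X := by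
  rw [DCProblem.f, broadcastProblem_g, broadcastProblem_h]

theorem continuousOn_logBarrier_box (hS : S.PosDef) : ContinuousOn (logBarrier S c) (box C) :=
  contDiffOn_logBarrier.continuousOn.mono (box_subset_logDetDom hS)

theorem exists_isMinimizer (hS₁ : S₁.PosDef) (hS₂ : S₂.PosDef) (hC : C.PosSemidef) :
    ∃ X, (broadcastProblem S₁ S₂ C lam).IsMinimizer X := by
  refine isCompact_box.exists_isMinOn ⟨0, zero_mem_box hC⟩ ?_
  exact ((continuousOn_logBarrier_box hS₁).sub (continuousOn_logBarrier_box hS₂)).congr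
    fun X _ => broadcastProblem_f_eq_sub X

theorem exists_isDCAStep (hS₁ : S₁.PosDef) (hC : C.PosSemidef) (X : SymMat n) :
    ∃ X', (broadcastProblem S₁ S₂ C lam).IsDCAStep X X' := by
  refine isCompact_box.exists_isMinOn ⟨0, zero_mem_box hC⟩ ?_
  rw [broadcastProblem_g]
  refine (continuousOn_logBarrier_box hS₁).sub (Continuous.continuousOn ?_)
  fun_prop

theorem gradient_g (hS₁ : S₁.PosDef) {X : SymMat n} (hX : X ∈ box C) :
    gradient (broadcastProblem S₁ S₂ C lam).g X = barrierGrad S₁ hS₁.isHermitian 1 X := by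
  rw [broadcastProblem_g]
  exact (hasGradientAt_logBarrier hS₁.isHermitian zero_le_one
    (box_subset_logDetDom hS₁ hX)).gradient

theorem gradient_h (hS₂ : S₂.PosDef) (hlam : 0 ≤ lam) {X : SymMat n} (hX : X ∈ box C) :
    gradient (broadcastProblem S₁ S₂ C lam).h X = barrierGrad S₂ hS₂.isHermitian lam X :=
  (hasGradientAt_logBarrier hS₂.isHermitian hlam (box_subset_logDetDom hS₂ hX)).gradient

theorem isMinimizer_normal (hS₁ : S₁.PosDef) (hS₂ : S₂.PosDef) (hlam : 0 ≤ lam) {X : SymMat n}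
    (hX : (broadcastProblem S₁ S₂ C lam).IsMinimizer X) :
    barrierGrad S₂ hS₂.isHermitian lam X - barrierGrad S₁ hS₁.isHermitian 1 X ∈
      normalConeAt (box C) X := by
  obtain ⟨hXb, hmin⟩ := hX
  have h1 := hasGradientAt_logBarrier hS₁.isHermitian zero_le_one (box_subset_logDetDom hS₁ hXb)
  have h2 := hasGradientAt_logBarrier hS₂.isHermitian hlam (box_subset_logDetDom hS₂ hXb)
  have h3 : HasGradientAt (broadcastProblem S₁ S₂ C lam).f
      (barrierGrad S₁ hS₁.isHermitian 1 X - barrierGrad S₂ hS₂.isHermitian lam X) X := by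
    rw [show (broadcastProblem S₁ S₂ C lam).f = fun Z => logBarrier S₁ 1 Z -
      logBarrier S₂ lam Z from funext broadcastProblem_f_eq_sub]
    exact h1.sub h2
  rw [← neg_sub]
  exact IsMinOn.neg_gradient_mem_normalConeAt hmin convex_box hXb h3

theorem isDCAStep_normal (hS₁ : S₁.PosDef) (hS₂ : S₂.PosDef) (hlam : 0 ≤ lam) {X X' : SymMat n}
    (hX : X ∈ box C) (hstep : (broadcastProblem S₁ S₂ C lam).IsDCAStep X X') :
    barrierGrad S₂ hS₂.isHermitian lam X - barrierGrad S₁ hS₁.isHermitian 1 X' ∈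
      normalConeAt (box C) X' := by
  obtain ⟨hXb, hmin⟩ := hstep
  rw [gradient_h hS₂ hlam hX, broadcastProblem_g] at hmin
  have h1 := hasGradientAt_logBarrier hS₁.isHermitian zero_le_one (box_subset_logDetDom hS₁ hXb)
  rw [← neg_sub]
  exact IsMinOn.neg_gradient_mem_normalConeAt hmin convex_box hXb
    (h1.sub (hasGradientAt_const_add_inner _ _ X X'))

/-- Quadratic growth: a minimizer satisfies the first-order conditions, so its gap vanishes. -/
theorem growth_of_isMinimizer (hS₁ : S₁.PosDef) (hS₂ : S₂.PosDef) (hlam : 0 ≤ lam) {K : ℝ}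
    (hbound : ErrorBound S₁ S₂ C lam c K) {X Z : SymMat n}
    (hX : (broadcastProblem S₁ S₂ C lam).IsMinimizer X) (hZ : Z ∈ box C) :
    c * ‖Z - X‖ ^ 2 ≤
      (broadcastProblem S₁ S₂ C lam).f Z - (broadcastProblem S₁ S₂ C lam).f X := by
  have h := hbound X hX.1 Z hZ _ (isMinimizer_normal hS₁ hS₂ hlam hX) (X.toMat + S₂)
    (box_subset_logDetDom hS₂ hX.1) (by
      rw [toMat_sub, toMat_barrierGrad, toMat_barrierGrad, neg_smul, neg_smul, one_smul]
      abel)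
  rw [logDetGap_self, mul_zero, norm_sub_rev] at h
  rw [broadcastProblem_f, broadcastProblem_f]
  linarith

/-- A DCA step decreases the objective by at least the Bregman distance of `h` between the iterates.
-/
theorem isDCAStep_descent (hS₂ : S₂.PosDef) (hlam : 0 ≤ lam) {X X' : SymMat n}
    (hX : X ∈ box C) (hstep : (broadcastProblem S₁ S₂ C lam).IsDCAStep X X') :
    (broadcastProblem S₁ S₂ C lam).f X' + lam * logDetGap (X'.toMat + S₂) (X.toMat + S₂) ≤
      (broadcastProblem S₁ S₂ C lam).f X := by
  have h := hstep.2 hX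
  rw [gradient_h hS₂ hlam hX] at h
  simp only [Set.mem_ofPred_eq, broadcastProblem_h, sub_self, inner_zero_right] at h
  have h2 := logBarrier_bregman (c := lam) hS₂.isHermitian X X'
  simp only [DCProblem.f, broadcastProblem_h]
  linarith

theorem isDCASequence_mem {X : ℕ → SymMat n}
    (hX : (broadcastProblem S₁ S₂ C lam).IsDCASequence X) (k : ℕ) : X k ∈ box C := by
  cases k with
  | zero => exact hX.1
  | succ k => exact (hX.2 k).1

/-- The new iterate `X'` satisfies the first-order conditions with `X + S₂` in the role of `Q`, so
the error bound at `X'` is in terms of the Bregman distance that the step gains. -/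
theorem isDCAStep_contraction (hS₁ : S₁.PosDef) (hS₂ : S₂.PosDef) (hlam : 1 < lam) {K : ℝ}
    (hc : 0 < c) (hK : 0 < K)
    (hbound : ErrorBound S₁ S₂ C lam c K) {X X' Z : SymMat n} (hX : X ∈ box C) (hZ : Z ∈ box C)
    (hstep : (broadcastProblem S₁ S₂ C lam).IsDCAStep X X') :
    (broadcastProblem S₁ S₂ C lam).f X' - (broadcastProblem S₁ S₂ C lam).f Z ≤
      1 / (1 + lam / K) *
        ((broadcastProblem S₁ S₂ C lam).f X - (broadcastProblem S₁ S₂ C lam).f Z) := by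
  have hl0 : 0 < lam := by linarith
  have h := hbound X' hstep.1 Z hZ _ (isDCAStep_normal hS₁ hS₂ hl0.le hX hstep) (X.toMat + S₂)
    (box_subset_logDetDom hS₂ hX) (by
      rw [toMat_sub, toMat_barrierGrad, toMat_barrierGrad, neg_smul, neg_smul, one_smul]
      abel)
  have hd := isDCAStep_descent hS₂ hl0.le hX hstep
  rw [← broadcastProblem_f (C := C), ← broadcastProblem_f (C := C)] at h
  set fX := (broadcastProblem S₁ S₂ C lam).f X
  set fX' := (broadcastProblem S₁ S₂ C lam).f X'
  set fZ := (broadcastProblem S₁ S₂ C lam).f Z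
  set G := logDetGap (X'.toMat + S₂) (X.toMat + S₂)
  have h1 : 0 ≤ c * ‖X' - Z‖ ^ 2 := by positivity
  have h2 : lam / K * (fX' - fZ) ≤ lam * G := by
    have : lam / K * (fX' - fZ) ≤ lam / K * (K * G) := by
      gcongr
      linarith
    refine this.trans_eq ?_
    field_simp
  rw [div_mul_eq_mul_div, le_div_iff₀ (by positivity)]
  linarith

theorem standingAssumption (hS₁ : S₁.PosDef) (hS₂ : S₂.PosDef) (hC : C.PosSemidef)
    (hlam : 1 < lam) {K r : ℝ} (hc : 0 < c) (hK : 0 < K) (hr : 0 < r)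
    (hbound : ErrorBound S₁ S₂ C lam c K) {Xs : SymMat n}
    (hXs : (broadcastProblem S₁ S₂ C lam).IsMinimizer Xs) :
    (broadcastProblem S₁ S₂ C lam).StandingAssumption Xs (lam / K) r := by
  have hl0 : 0 < lam := by linarith
  refine
    { g_convex := by
        rw [broadcastProblem_g]
        exact isClosedConvexC1_logBarrier hS₁.isHermitian one_pos
      h_convex := isClosedConvexC1_logBarrier hS₂.isHermitian hl0
      feas_bounded := isBounded_box
      feas_closed := isClosed_box
      feas_convex := convex_box
      feas_subset := fun X hX => ⟨box_subset_logDetDom hS₁ hX, box_subset_logDetDom hS₂ hX⟩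
      minimizer := hXs
      solvable := fun X _ => exists_isDCAStep hS₁ hC X
      mu_pos := by positivity
      r_pos := hr
      conj_regular := fun X hX => ?_
      dcPL := fun X hX Y hY _ => ?_ }
  · have hV := neg_toMat_barrierGrad_posDef hS₂.isHermitian hl0 (box_subset_logDetDom hS₂ hX)
    rw [gradient_h hS₂ hl0.le hX]
    exact ⟨mem_interior_effDom_convexConj hS₂.isHermitian hl0 hV,
      differentiableAt_convexConj hS₂.isHermitian hl0 hV⟩
  · rw [gradient_h hS₂ hl0.le hX, gradient_g hS₁ hX]
    set U := barrierGrad S₁ hS₁.isHermitian 1 X + Y with hU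
    change _ ≤ bregman (convexConj (logDetDom S₂) (logBarrier S₂ lam)) U _
    by_cases hUpd : (-U.toMat).PosDef
    · rw [bregman_convexConj hS₂.isHermitian hl0 (box_subset_logDetDom hS₂ hX) hUpd,
        EReal.coe_le_coe_iff]
      have h := hbound X hX Xs hXs.1 Y hY _ (hUpd.inv.smul hl0) (by
        rw [smul_inv_smul_inv hUpd hl0.ne', hU, toMat_add, toMat_barrierGrad,
          neg_smul, one_smul]
        abel)
      rw [broadcastProblem_f, broadcastProblem_f]
      have h1 : 0 ≤ c * ‖X - Xs‖ ^ 2 := by positivity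
      set G := logDetGap (X.toMat + S₂) (lam • (-U.toMat)⁻¹)
      calc _ ≤ lam / K * (K * G) := by
            gcongr
            linarith
        _ = lam * G := by field_simp
    · rw [bregman_convexConj_eq_top hS₂ hl0 (box_subset_logDetDom hS₂ hX) hUpd]
      exact le_top

end SymMat

open SymMat in
theorem mainTheorem2 (n : ℕ) (S₁ S₂ C : Matrix (Fin n) (Fin n) ℝ) (lam : ℝ)
    (hS₁ : S₁.PosDef) (hS₂ : S₂.PosDef) (hC : C.PosSemidef) (hlam : 1 < lam) :
    ∃ (Xs : SymMat n) (μ r : ℝ),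
      (broadcastProblem S₁ S₂ C lam).StandingAssumption Xs μ r ∧
      (∀ X ∈ (broadcastProblem S₁ S₂ C lam).feas, ∀ Z ∈ (broadcastProblem S₁ S₂ C lam).feas,
        ‖gradient (broadcastProblem S₁ S₂ C lam).g X‖ +
          ‖gradient (broadcastProblem S₁ S₂ C lam).h Z‖ < r) ∧
      (∀ X, (broadcastProblem S₁ S₂ C lam).IsMinimizer X → X = Xs) ∧
      (∀ X : ℕ → SymMat n, (broadcastProblem S₁ S₂ C lam).IsDCASequence X → ∀ k,
        (broadcastProblem S₁ S₂ C lam).f (X (k + 1)) - (broadcastProblem S₁ S₂ C lam).f Xs ≤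
          1 / (1 + μ) *
            ((broadcastProblem S₁ S₂ C lam).f (X k) - (broadcastProblem S₁ S₂ C lam).f Xs)) ∧
      (∃ M ρ : ℝ, 0 ≤ ρ ∧ ρ < 1 ∧
        ∀ X : ℕ → SymMat n, (broadcastProblem S₁ S₂ C lam).IsDCASequence X →
          Tendsto X atTop (𝓝 Xs) ∧ ∀ k, ‖X k - Xs‖ ≤ M * ρ ^ k) := by
  have hl0 : 0 < lam := by linarith
  obtain ⟨c, K, hc, hK, hbound⟩ := exists_errorBound hlam hS₁ hS₂ hC
  obtain ⟨Xs, hXs⟩ := exists_isMinimizer (lam := lam) hS₁ hS₂ hC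
  set P := broadcastProblem S₁ S₂ C lam with hP
  have i1 := hS₁.inv.posSemidef.trace_nonneg
  have i2 := hS₂.inv.posSemidef.trace_nonneg
  have hgrowth : ∀ Z ∈ box C, c * ‖Z - Xs‖ ^ 2 ≤ P.f Z - P.f Xs := fun Z hZ =>
    growth_of_isMinimizer hS₁ hS₂ hl0.le hbound hXs hZ
  have hcontr : ∀ X : ℕ → SymMat n, P.IsDCASequence X → ∀ k,
      P.f (X (k + 1)) - P.f Xs ≤ 1 / (1 + lam / K) * (P.f (X k) - P.f Xs) := fun X hX k =>
    isDCAStep_contraction hS₁ hS₂ hlam hc hK hbound (isDCASequence_mem hX k) hXs.1 (hX.2 k)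
  refine ⟨Xs, lam / K, S₁⁻¹.trace + lam * S₂⁻¹.trace + 1,
    standingAssumption hS₁ hS₂ hC hlam hc hK (by positivity) hbound hXs, ?_, ?_, hcontr, ?_⟩
  · intro X hX Z hZ
    rw [gradient_g hS₁ hX, gradient_h hS₂ hl0.le hZ]
    have h1 := norm_barrierGrad_le hS₁ zero_le_one hX
    have h2 := norm_barrierGrad_le hS₂ hl0.le hZ
    linarith
  · intro X hX
    have h1 := hgrowth X hX.1
    have h2 : P.f X ≤ P.f Xs := hX.2 hXs.1
    have h3 : ‖X - Xs‖ ^ 2 ≤ 0 := by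
      by_contra! h
      have := mul_pos hc h
      linarith
    have h4 : ‖X - Xs‖ = 0 := pow_eq_zero_iff two_ne_zero |>.1 (le_antisymm h3 (sq_nonneg _))
    exact sub_eq_zero.1 (norm_eq_zero.1 h4)
  · set q : ℝ := 1 / (1 + lam / K) with hq
    have hμ : 0 < lam / K := by positivity
    have hq0 : 0 ≤ q := by positivity
    have hq1 : q < 1 := by
      rw [hq, div_lt_one (by positivity)]
      linarith
    set B : ℝ := (S₁⁻¹.trace + lam * S₂⁻¹.trace) * (2 * C.trace) with hB
    have hρ1 : √q < 1 := by rw [Real.sqrt_lt' one_pos]; simpa using hq1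
    refine ⟨√(B / c), √q, Real.sqrt_nonneg _, hρ1, fun X hX => ?_⟩
    have hδ : ∀ k, P.f (X k) - P.f Xs ≤ q ^ k * B := by
      intro k
      induction k with
      | zero =>
        have h0 := isDCASequence_mem hX 0
        have h1 := logDetDiff_sub_le hlam hS₁ hS₂ h0.1 hXs.1.1
        rw [← broadcastProblem_f (C := C), ← broadcastProblem_f (C := C)] at h1
        refine h1.trans ?_
        rw [pow_zero, one_mul, hB]
        gcongr
        exact norm_sub_le_of_feasible h0.1 h0.2 hXs.1.1 hXs.1.2
      | succ k ih =>
        calc _ ≤ q * (P.f (X k) - P.f Xs) := hcontr X hX k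
          _ ≤ q * (q ^ k * B) := by gcongr
          _ = _ := by ring
    have hnorm : ∀ k, ‖X k - Xs‖ ≤ √(B / c) * √q ^ k := by
      intro k
      have h1 := (hgrowth (X k) (isDCASequence_mem hX k)).trans (hδ k)
      have h2 : ‖X k - Xs‖ ^ 2 ≤ (B / c) * q ^ k := by
        rw [div_mul_eq_mul_div, le_div_iff₀ hc]
        linarith
      have h3 : √q ^ k = √(q ^ k) := by
        rw [← Real.sqrt_sq (pow_nonneg (Real.sqrt_nonneg q) k), ← pow_mul, mul_comm k 2, pow_mul,
          Real.sq_sqrt hq0]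
      have hB0 : 0 ≤ B / c := by
        have := hC.trace_nonneg
        positivity
      rw [h3, ← Real.sqrt_mul hB0]
      exact Real.le_sqrt_of_sq_le h2
    refine ⟨?_, hnorm⟩
    rw [tendsto_iff_norm_sub_tendsto_zero]
    refine squeeze_zero (fun _ => norm_nonneg _) hnorm ?_
    simpa using
      (tendsto_pow_atTop_nhds_zero_of_lt_one (Real.sqrt_nonneg q) hρ1).const_mul (√(B / c))
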